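/- Let $z_0\in\mathbb C$. For $f$ meromorphic in $\overline{\mathbb C}\setminus\{z_0\}$ (so also at $\infty$) let $n(t,f)$ be the number of poles of $f$, with multiplicity, in $\{z\in\mathbb C: |z-z_0|\ge t\}\cup\{\infty\}$, let $n(\infty,f)$ be the multiplicity of $\infty$ as a pole of $f$, and put $$N_{z_0}(r,f)=\int_r^\infty\frac{n(t,f)-n(\infty,f)}{t}\,dt-n(\infty,f)\log r,\qquad m_{z_0}(r,f)=\frac1{2\pi}\int_0^{2\pi}\log^+|f(z_0-re^{i\phi})|\,d\phi,$$ $$T_{z_0}(r,f)=m_{z_0}(r,f)+N_{z_0}(r,f).$$ Put $$\sigma_{\log}(f)=\limsup_{r\to0^+}\frac{\log^+T_{z_0}(r,f)}{\log\log\frac1r},\qquad \mu_{\log}(f)=\liminf_{r\to0^+}\frac{\log^+T_{z_0}(r,f)}{\log\log\frac1r},\qquad \mu_{[2,2]}(f)=\liminf_{r\to0^+}\frac{\log^+\log^+T_{z_0}(r,f)}{\log\log\frac1r},$$ and, when the exponent is finite, $$\tau_{\log}(f)=\limsup_{r\to0^+}\frac{T_{z_0}(r,f)}{(\log\frac1r)^{\sigma_{\log}(f)}},\qquad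 \underline\tau_{\log}(f)=\liminf_{r\to0^+}\frac{T_{z_0}(r,f)}{(\log\frac1r)^{\mu_{\log}(f)}}.$$ **Theorem.** Let $k\ge1$ and let $A_0,\dots,A_{k-1}$ be meromorphic in $\overline{\mathbb C}\setminus\{z_0\}$ with $\sigma_{\log}(A_j)<\infty$ for $0\le j\le k-1$. Assume that $$\liminf_{r\to0^+}\frac{m_{z_0}(r,A_0)}{T_{z_0}(r,A_0)}=\delta>0,\qquad \max_{1\le j\le k-1}\sigma_{\log}(A_j)\le\mu_{\log}(A_0)$$ (the second condition being void if $k=1$) and $$\sum_{\substack{1\le j\le k-1\\ \sigma_{\log}(A_j)=\mu_{\log}(A_0)\ge1}}\tau_{\log}(A_j)<\delta\,\underline\tau_{\log}(A_0)<\infty .$$ Then every meromorphic solution $f\not\equiv0$ in $\overline{\mathbb C}\setminus\{z_0\}$ of $$f^{(k)}+A_{k-1}f^{(k-1)}+\dots+A_1f'+A_0f=0$$ satisfies $0\le\mu_{\log}(A_0)-1\le\mu_{[2,2]}(f)$, and moreover $\mu_{\log}(A_0)\le\mu_{[2,2]}(f)$ if $\mu_{\log}(A_0)>1$. -/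

import Mathlib

open Filter Topology

namespace NevanlinnaNear

/-- `f` is meromorphic in the Riemann sphere minus the finite point `z₀`: at every finite point
other than `z₀`, and at infinity. The value `f z₀` plays no role. -/
def MeromorphicOffPoint (f : ℂ → ℂ) (z₀ : ℂ) : Prop :=
  MeromorphicOn f {z₀}ᶜ ∧ MeromorphicAt (fun w : ℂ => f w⁻¹) 0

/-- Multiplicity of the finite point `z` as a pole of `f` (zero if `z` is not a pole). -/
noncomputable def poleMult (f : ℂ → ℂ) (z : ℂ) : ℕ :=
  (-(meromorphicOrderAt f z).untop₀).toNat

/-- `n(∞, f)`: multiplicity of infinity as a pole of `f` (zero if it is not a pole). -/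
noncomputable def poleMultInfty (f : ℂ → ℂ) : ℕ :=
  poleMult (fun w : ℂ => f w⁻¹) 0

/-- `n(t, f)`: number of poles of `f`, with multiplicity, in `{z : t ≤ |z - z₀|} ∪ {∞}`. -/
noncomputable def countPoles (f : ℂ → ℂ) (z₀ : ℂ) (t : ℝ) : ℕ :=
  (∑ᶠ (z : ℂ) (_ : t ≤ ‖z - z₀‖), poleMult f z) + poleMultInfty f

/-- Counting function
`N_{z₀}(r, f) = -∫_∞^r (n(t, f) - n(∞, f)) / t dt - n(∞, f) log r`. -/
noncomputable def counting (f : ℂ → ℂ) (z₀ : ℂ) (r : ℝ) : ℝ :=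
  (∫ t in Set.Ioi r, ((countPoles f z₀ t : ℝ) - (poleMultInfty f : ℝ)) / t)
    - (poleMultInfty f : ℝ) * Real.log r

/-- Proximity function `m_{z₀}(r, f)`: the mean of `log⁺ |f|` over the circle `|z - z₀| = r`. -/
noncomputable def proximity (f : ℂ → ℂ) (z₀ : ℂ) (r : ℝ) : ℝ :=
  Real.circleAverage (fun z => Real.posLog ‖f z‖) z₀ r

/-- Characteristic function `T_{z₀}(r, f) = m_{z₀}(r, f) + N_{z₀}(r, f)`. -/
noncomputable def characteristic (f : ℂ → ℂ) (z₀ : ℂ) (r : ℝ) : ℝ :=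
  proximity f z₀ r + counting f z₀ r

/-- The order `σ_{[p,q]}(f, z₀)`: upper limit, as `r → 0+`, of the `p`-fold iterate of `log⁺` at
`T_{z₀}(r, f)` over the `q`-fold iterate of `log` at `1 / r`. -/
noncomputable def order (p q : ℕ) (f : ℂ → ℂ) (z₀ : ℂ) : EReal :=
  limsup (fun r : ℝ =>
    ((Real.posLog^[p] (characteristic f z₀ r) / Real.log^[q] (1 / r) : ℝ) : EReal)) (𝓝[>] 0)

/-- The lower order `μ_{[p,q]}(f, z₀)`: the corresponding lower limit. -/
noncomputable def lowerOrder (p q : ℕ) (f : ℂ → ℂ) (z₀ : ℂ) : EReal :=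
  liminf (fun r : ℝ =>
    ((Real.posLog^[p] (characteristic f z₀ r) / Real.log^[q] (1 / r) : ℝ) : EReal)) (𝓝[>] 0)

/-- Logarithmic order `σ_log(f, z₀) = σ_{[1,2]}(f, z₀)`. -/
noncomputable def logOrder (f : ℂ → ℂ) (z₀ : ℂ) : EReal := order 1 2 f z₀

/-- Logarithmic lower order `μ_log(f, z₀) = μ_{[1,2]}(f, z₀)`. -/
noncomputable def logLowerOrder (f : ℂ → ℂ) (z₀ : ℂ) : EReal := lowerOrder 1 2 f z₀

/-- Logarithmic type `τ_log(f, z₀)`, meaningful when the logarithmic order is finite. -/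
noncomputable def logType (f : ℂ → ℂ) (z₀ : ℂ) : EReal :=
  limsup (fun r : ℝ =>
    ((characteristic f z₀ r / Real.log (1 / r) ^ (logOrder f z₀).toReal : ℝ) : EReal)) (𝓝[>] 0)

/-- Logarithmic lower type, meaningful when the logarithmic lower order is finite. -/
noncomputable def logLowerType (f : ℂ → ℂ) (z₀ : ℂ) : EReal :=
  liminf (fun r : ℝ =>
    ((characteristic f z₀ r / Real.log (1 / r) ^ (logLowerOrder f z₀).toReal : ℝ) : EReal))
    (𝓝[>] 0)

/-- `f` solves `f^(k) + A_{k-1} f^(k-1) + ⋯ + A_1 f' + A_0 f = 0` as an identity between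
meromorphic functions off `z₀`, that is, outside a discrete subset of `ℂ \ {z₀}`. -/
def IsSolution (k : ℕ) (A : ℕ → ℂ → ℂ) (z₀ : ℂ) (f : ℂ → ℂ) : Prop :=
  ∀ᶠ z in codiscreteWithin ({z₀}ᶜ : Set ℂ),
    iteratedDeriv k f z + ∑ j ∈ Finset.range k, A j z * iteratedDeriv j f z = 0

end NevanlinnaNear

namespace NevanlinnaNear

open Real MeasureTheory

/-! ### Circle averages of `‖z - u‖ ^ (-1/2)` -/

/-! In the coordinate `w = 1 / (z - z₀)` a function meromorphic off `z₀`, also at infinity, becomes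
a meromorphic function `F` on the plane. The circle of radius `r` becomes that of radius `R = 1 /
r`, the characteristic near `z₀` becomes the classical one, and `d/dz` becomes `D = -w² d/dw`. Write
`k` for the order of the equation, `L = log (1 / r)` and `μ` for the logarithmic lower order of `A
0`.

Dividing the equation by `F` expresses `-A 0` through the quotients `D^j F / F` and the other
coefficients. The lemma on the logarithmic derivative (`exists_proximity_logDeriv_le`) bounds the
proximity of each quotient by `O(1 + log R + log⁺ T(6^j R, F))`, so `m(r, A 0) ≤ ∑ T(r, A j) + O(1 +
L + log⁺ T(r / 6^k, f))`. If `μ > 1`, the hypothesis on types leaves a strict gap between `m(r, A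
0)` and the sum, of size a positive multiple of `L^μ`. The term `O(L)` is absorbed, so `log⁺ T` is
at least a multiple of `L^μ`. Rescaling `r` by a constant does not affect the order.

If `μ < 1`, every coefficient has lower order below `1`. A nonconstant meromorphic function has
characteristic at least `log R - C`, so all coefficients are constant. As `w → 0` the quotients `D^j
F / F` with `j ≥ 1` tend to `0`, whence `A 0 = 0` and its proximity vanishes, against `δ > 0`. For
`μ = 1` the bound is the nonnegativity of the order of `f`.

The lemma on the logarithmic derivative comes from factoring `F` in a disk into canonical factors
and a zero-free `h`. The Herglotz formula bounds `h' / h`; the terms `1 / |w - u|` are averaged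
after taking square roots. A comparison radius of size comparable to `R` removes the usual
exceptional set. -/

theorem intervalIntegrable_abs_sin_rpow (a b : ℝ) :
    IntervalIntegrable (fun θ : ℝ => |sin θ| ^ (-(1 / 2) : ℝ)) volume a b := by
  have hper : Function.Periodic (fun θ : ℝ => |sin θ| ^ (-(1 / 2) : ℝ)) π := by
    intro θ
    simp [sin_add_pi]
  have hmeas : Measurable (fun θ : ℝ => |sin θ| ^ (-(1 / 2) : ℝ)) := by fun_prop
  have h1 : IntervalIntegrable (fun θ : ℝ => |sin θ| ^ (-(1 / 2) : ℝ)) volume 0 (π / 2) := by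
    -- Jordan's inequality `2 / π * θ ≤ sin θ` gives an integrable majorant. Reflection in `π / 2`
    -- and periodicity do the rest.
    have hg : IntervalIntegrable (fun θ : ℝ => (2 / π) ^ (-(1 / 2) : ℝ) * θ ^ (-(1 / 2) : ℝ))
        volume 0 (π / 2) :=
      (intervalIntegral.intervalIntegrable_rpow' (by norm_num)).const_mul _
    refine hg.mono_fun' hmeas.aestronglyMeasurable ?_
    rw [Set.uIoc_of_le (by positivity)]
    refine (ae_restrict_iff' measurableSet_Ioc).2 (ae_of_all _ fun θ hθ => ?_)
    have hs := mul_le_sin hθ.1.le hθ.2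
    have hp : 0 < 2 / π * θ := mul_pos (by positivity) hθ.1
    simp only
    rw [norm_eq_abs, abs_of_nonneg (by positivity), ← mul_rpow (by positivity) hθ.1.le,
      abs_of_pos (hp.trans_le hs)]
    exact rpow_le_rpow_of_nonpos hp hs (by norm_num)
  have h2 : IntervalIntegrable (fun θ : ℝ => |sin θ| ^ (-(1 / 2) : ℝ)) volume (π / 2) π := by
    have := (h1.comp_sub_left π).symm
    simp only [sub_zero, sin_pi_sub] at this
    convert this using 1
    ring
  exact hper.intervalIntegrable pi_ne_zero (t := 0) (by simpa using h1.trans h2) a b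

/-- Rotate `u` onto the nonnegative real axis; the distance is then at least the imaginary part. The
bound depends on `u` only through its argument. -/
theorem abs_sin_le_norm_circleMap_sub {R : ℝ} (hR : 1 ≤ R) (u : ℂ) (θ : ℝ) :
    |sin (θ - u.arg)| ≤ ‖circleMap 0 R θ - u‖ := by
  have h1 : (circleMap 0 R θ - u) * Complex.exp (-(u.arg : ℂ) * Complex.I)
      = circleMap 0 R (θ - u.arg) - (‖u‖ : ℂ) := by
    nth_rewrite 1 [← Complex.norm_mul_exp_arg_mul_I u]
    simp only [circleMap, zero_add, sub_mul, mul_assoc, ← Complex.exp_add]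
    push_cast
    ring_nf
    simp
  have h2 : ‖Complex.exp (-(u.arg : ℂ) * Complex.I)‖ = 1 := by
    have := Complex.norm_exp_ofReal_mul_I (-u.arg)
    push_cast at this
    exact this
  have h3 : ‖circleMap 0 R θ - u‖ = ‖circleMap 0 R (θ - u.arg) - (‖u‖ : ℂ)‖ := by
    rw [← h1, norm_mul, h2, mul_one]
  have h4 : (circleMap 0 R (θ - u.arg) - (‖u‖ : ℂ)).im = R * sin (θ - u.arg) := by
    simp [circleMap, Complex.exp_im]
  rw [h3]
  refine le_trans ?_ (Complex.abs_im_le_norm _)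
  rw [h4, abs_mul, abs_of_nonneg (by linarith : 0 ≤ R)]
  exact le_mul_of_one_le_left (abs_nonneg _) hR

/-- The zeros of the sine must be excluded: there the right side is `0 ^ (-1/2) = 0` by convention.
-/
theorem ae_norm_circleMap_sub_rpow_le {R : ℝ} (hR : 1 ≤ R) (u : ℂ) :
    ∀ᵐ θ : ℝ, ‖circleMap 0 R θ - u‖ ^ (-(1 / 2) : ℝ) ≤ |sin (θ - u.arg)| ^ (-(1 / 2) : ℝ) := by
  have hc : (Set.range fun n : ℤ => (n : ℝ) * π + u.arg).Countable := Set.countable_range _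
  filter_upwards [hc.ae_notMem volume] with θ hθ
  have : sin (θ - u.arg) ≠ 0 := by
    intro h
    obtain ⟨n, hn⟩ := sin_eq_zero_iff.1 h
    exact hθ ⟨n, by simp [hn]⟩
  exact rpow_le_rpow_of_nonpos (abs_pos.2 this) (abs_sin_le_norm_circleMap_sub hR u θ)
    (by norm_num)

theorem intervalIntegrable_abs_sin_sub_rpow (φ a b : ℝ) :
    IntervalIntegrable (fun θ : ℝ => |sin (θ - φ)| ^ (-(1 / 2) : ℝ)) volume a b := by
  simpa using (intervalIntegrable_abs_sin_rpow (a - φ) (b - φ)).comp_sub_right φ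

theorem circleIntegrable_norm_sub_rpow {R : ℝ} (hR : 1 ≤ R) (u : ℂ) :
    CircleIntegrable (fun z => ‖z - u‖ ^ (-(1 / 2) : ℝ)) 0 R := by
  refine (intervalIntegrable_abs_sin_sub_rpow u.arg 0 (2 * π)).mono_fun'
    (Measurable.aestronglyMeasurable (by fun_prop)) ?_
  filter_upwards [ae_restrict_of_ae (ae_norm_circleMap_sub_rpow_le hR u)] with θ hθ
  rwa [norm_eq_abs, abs_of_nonneg (by positivity)]

/-- By periodicity the mean of the sine majorant does not depend on `arg u`, hence one `K` serves
all `R` and `u`. -/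
theorem exists_circleAverage_norm_sub_rpow_le :
    ∃ K : ℝ, 0 ≤ K ∧ ∀ R : ℝ, 1 ≤ R → ∀ u : ℂ,
      circleAverage (fun z => ‖z - u‖ ^ (-(1 / 2) : ℝ)) 0 R ≤ K := by
  refine ⟨(2 * π)⁻¹ * ∫ θ in (0 : ℝ)..2 * π, |sin θ| ^ (-(1 / 2) : ℝ), ?_, fun R hR u => ?_⟩
  · refine mul_nonneg (by positivity) (intervalIntegral.integral_nonneg (by positivity) ?_)
    intro θ _
    positivity
  · rw [circleAverage_def, smul_eq_mul]
    gcongr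
    have hper : Function.Periodic (fun θ : ℝ => |sin θ| ^ (-(1 / 2) : ℝ)) (2 * π) := by
      intro θ
      simp
    calc ∫ θ in (0 : ℝ)..2 * π, ‖circleMap 0 R θ - u‖ ^ (-(1 / 2) : ℝ)
        ≤ ∫ θ in (0 : ℝ)..2 * π, |sin (θ - u.arg)| ^ (-(1 / 2) : ℝ) := by
          refine intervalIntegral.integral_mono_ae (by positivity)
            (circleIntegrable_norm_sub_rpow hR u)
            (intervalIntegrable_abs_sin_sub_rpow u.arg 0 (2 * π))
            (ae_norm_circleMap_sub_rpow_le hR u)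
      _ = ∫ θ in (0 : ℝ)..2 * π, |sin θ| ^ (-(1 / 2) : ℝ) := by
          rw [intervalIntegral.integral_comp_sub_right (fun θ => |sin θ| ^ (-(1 / 2) : ℝ))]
          have := hper.intervalIntegral_add_eq (0 - u.arg) 0
          rw [zero_add] at this
          rw [← this]
          congr 1
          ring

/-! ### Logarithmic derivatives of zero-free functions -/

open Metric InnerProductSpace

/-- A zero-free analytic function on a closed disk has logarithmic derivative controlled by the
mean of `|log ‖h‖|` over the boundary circle. -/
theorem norm_logDeriv_le_circleAverage {h : ℂ → ℂ} {ρ : ℝ} {w : ℂ}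
    (hh : AnalyticOnNhd ℂ h (closedBall 0 ρ)) (hne : ∀ z ∈ closedBall (0 : ℂ) ρ, h z ≠ 0)
    (hw : w ∈ ball (0 : ℂ) ρ) :
    ‖logDeriv h w‖ ≤ 2 * ρ / (ρ - ‖w‖) ^ 2 * circleAverage (fun z => |log ‖h z‖|) 0 ρ := by
  have hρ : 0 < ρ := pos_of_mem_ball hw
  set g : ℂ → ℝ := fun z => log ‖h z‖ with hg
  have hharm : HarmonicOnNhd g (closedBall 0 ρ) := fun z hz =>
    (hh z hz).harmonicAt_log_norm (hne z hz)
  have hcont : ContinuousOn g (sphere 0 ρ) := by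
    intro z hz
    have hz' := sphere_subset_closedBall hz
    exact ((hh z hz').continuousAt.norm.log (norm_ne_zero_iff.2 (hne z hz'))).continuousWithinAt
  have hint : CircleIntegrable g 0 ρ := hcont.circleIntegrable hρ.le
  have hintC : CircleIntegrable (fun z => (g z : ℂ)) 0 ρ :=
    (Complex.continuous_ofReal.comp_continuousOn hcont).circleIntegrable hρ.le
  -- The Herglotz integral of `log ‖h‖` is an analytic function with real part `log ‖h‖`, so its
  -- derivative is the logarithmic derivative of `h`.
  set G : ℂ → ℂ := fun w => circleAverage (fun ζ => herglotzRieszKernel 0 w ζ • (g ζ : ℂ)) 0 ρ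
    with hG
  have hre : ∀ x ∈ ball (0 : ℂ) ρ, (G x).re = g x := by
    intro x hx
    rw [hG]
    simp only
    rw [re_circleAverage_herglotzRieszKernel_smul hint hx]
    exact hharm.circleAverage_re_herglotzRieszKernel_smul hx
  have hder : ∀ x ∈ ball (0 : ℂ) ρ, HasDerivAt G
      (circleAverage (fun ζ => (2 * ζ / (ζ - x) ^ 2) • (g ζ : ℂ)) 0 ρ) x := fun x hx =>
    hasDerivAt_circleAverage_herglotzRieszKernel_smul hintC hx
  -- the quotient `h / exp G` has constant modulus `1`
  have hq : ∀ᶠ z in 𝓝 w, z ∈ ball (0 : ℂ) ρ := isOpen_ball.mem_nhds hw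
  have hnorm : ∀ z ∈ ball (0 : ℂ) ρ, ‖h z * Complex.exp (-G z)‖ = 1 := by
    intro z hz
    have hz0 : 0 < ‖h z‖ := norm_pos_iff.2 (hne z (ball_subset_closedBall hz))
    rw [norm_mul, Complex.norm_exp, Complex.neg_re, hre z hz, hg]
    simp only
    rw [exp_neg, exp_log hz0, mul_inv_cancel₀ hz0.ne']
  have hdiff : ∀ z ∈ ball (0 : ℂ) ρ, DifferentiableAt ℂ (fun z => h z * Complex.exp (-G z)) z := by
    intro z hz
    exact (hh z (ball_subset_closedBall hz)).differentiableAt.mul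
      ((hder z hz).differentiableAt.neg.cexp)
  -- Constant modulus makes every point a local maximum of the norm, and the maximum principle gives
  -- local constancy.
  have hconst : ∀ᶠ y in 𝓝 w, h y * Complex.exp (-G y) = h w * Complex.exp (-G w) := by
    refine Complex.eventually_eq_of_isLocalMax_norm (f := fun z => h z * Complex.exp (-G z))
      (hq.mono fun z hz => hdiff z hz) ?_
    filter_upwards [hq] with z hz
    simp only [Function.comp_apply]
    rw [hnorm z hz, hnorm w hw]
  have hzero : deriv (fun z => h z * Complex.exp (-G z)) w = 0 := by
    have : (fun z => h z * Complex.exp (-G z)) =ᶠ[𝓝 w] fun _ => h w * Complex.exp (-G w) := hconst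
    rw [this.deriv_eq, deriv_const]
  have hprod := ((hh w (ball_subset_closedBall hw)).differentiableAt.hasDerivAt.mul
    (hder w hw).neg.cexp).deriv
  have hfun : (h * fun x => Complex.exp ((-G) x)) = fun z => h z * Complex.exp (-G z) := rfl
  have hlog : logDeriv h w = circleAverage (fun ζ => (2 * ζ / (ζ - w) ^ 2) • (g ζ : ℂ)) 0 ρ := by
    rw [hfun, hzero] at hprod
    rw [logDeriv_apply, div_eq_iff (hne w (ball_subset_closedBall hw))]
    have he := Complex.exp_ne_zero (-G w)
    have : Complex.exp (-G w) * (deriv h w -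
        circleAverage (fun ζ => (2 * ζ / (ζ - w) ^ 2) • (g ζ : ℂ)) 0 ρ * h w) = 0 := by
      simp only [Pi.neg_apply] at hprod
      linear_combination -hprod
    exact sub_eq_zero.1 ((mul_eq_zero.1 this).resolve_left he)
  rw [hlog, circleAverage_def, circleAverage_def, norm_smul, smul_eq_mul, ← mul_assoc,
    mul_comm (2 * ρ / (ρ - ‖w‖) ^ 2), mul_assoc, norm_of_nonneg (by positivity : 0 ≤ (2 * π)⁻¹)]
  gcongr
  rw [← intervalIntegral.integral_const_mul]
  refine intervalIntegral.norm_integral_le_of_norm_le (by positivity) ?_ ?_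
  · refine ae_of_all _ fun θ _ => ?_
    have hwρ : ‖w‖ < ρ := by simpa using hw
    have hd : ρ - ‖w‖ ≤ ‖circleMap 0 ρ θ - w‖ := by
      have := norm_sub_norm_le (circleMap 0 ρ θ) w
      rwa [norm_circleMap_zero, abs_of_pos hρ] at this
    rw [norm_smul, norm_div, norm_mul, norm_pow, norm_circleMap_zero, abs_of_pos hρ,
      Complex.norm_real, norm_eq_abs, Complex.norm_ofNat]
    have : 0 < ρ - ‖w‖ := by linarith
    gcongr
  · exact (IntervalIntegrable.norm hint).const_mul _

end NevanlinnaNear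

namespace NevanlinnaNear

open Real MeasureTheory Metric MeromorphicOn
open Complex (canonicalFactor canonicalFactor_ne_zero canonicalFactor_def canonicalFactor_apply
  meromorphic_canonicalFactor norm_canonicalFactor_eval_circle_eq_one
  meromorphicOrderAt_canonicalFactor_ne_top)

/-! ### The lemma on the logarithmic derivative -/

/-- Circle averages ignore discrete sets, so `g` may be replaced by `max f g`, which dominates `f`
everywhere. -/
theorem circleAverage_le_of_le_codiscreteWithin {f g : ℂ → ℝ} {R : ℝ} (hR : R ≠ 0)
    (hf : CircleIntegrable f 0 R) (hg : CircleIntegrable g 0 R)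
    (h : ∀ᶠ z in codiscreteWithin (sphere (0 : ℂ) |R|), f z ≤ g z) :
    circleAverage f 0 R ≤ circleAverage g 0 R := by
  have heq : (fun z => max (f z) (g z)) =ᶠ[codiscreteWithin (sphere (0 : ℂ) |R|)] g := by
    filter_upwards [h] with z hz
    exact max_eq_right hz
  rw [← circleAverage_congr_codiscreteWithin heq hR]
  exact circleAverage_mono hf (hg.congr_codiscreteWithin heq.symm) fun z _ => le_max_left _ _

theorem logDeriv_canonicalFactor {ρ : ℝ} {u w : ℂ} (hu : u ∈ ball (0 : ℂ) ρ)
    (hw : w ∈ closedBall (0 : ℂ) ρ) (hwu : w ≠ u) :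
    logDeriv (canonicalFactor ρ u) w
      = -(starRingEnd ℂ u) / (ρ ^ 2 - (starRingEnd ℂ u) * w) - (w - u)⁻¹ := by
  have hρ : (ρ : ℂ) ≠ 0 := by exact_mod_cast (pos_of_mem_ball hu).ne'
  have h1 := canonicalFactor_ne_zero hu hw hwu
  rw [canonicalFactor_apply] at h1
  have h2 : (ρ : ℂ) ^ 2 - (starRingEnd ℂ u) * w ≠ 0 := (div_ne_zero_iff.1 h1).1
  have h3 : w - u ≠ 0 := sub_ne_zero.2 hwu
  rw [canonicalFactor_def, logDeriv_div (f := fun z => (ρ : ℂ) ^ 2 - (starRingEnd ℂ u) * z)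
    (g := fun z => (ρ : ℂ) * (z - u)) w h2 (mul_ne_zero hρ h3) (by fun_prop) (by fun_prop),
    logDeriv_const_mul w _ hρ, logDeriv_apply, logDeriv_apply]
  simp

theorem norm_logDeriv_canonicalFactor_le {ρ : ℝ} {u w : ℂ} (hu : u ∈ ball (0 : ℂ) ρ)
    (hw : w ∈ ball (0 : ℂ) ρ) (hwu : w ≠ u) :
    ‖logDeriv (canonicalFactor ρ u) w‖ ≤ ‖w - u‖⁻¹ + (ρ - ‖w‖)⁻¹ := by
  have hρ := pos_of_mem_ball hu
  rw [logDeriv_canonicalFactor hu (ball_subset_closedBall hw) hwu, add_comm]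
  refine (norm_sub_le _ _).trans ?_
  rw [mem_ball_zero_iff] at hu hw
  rw [norm_inv, norm_div, norm_neg, RCLike.norm_conj]
  gcongr
  have h1 : ρ * (ρ - ‖w‖) ≤ ‖(ρ : ℂ) ^ 2 - (starRingEnd ℂ u) * w‖ := by
    have := norm_sub_norm_le ((ρ : ℂ) ^ 2) ((starRingEnd ℂ u) * w)
    rw [norm_mul, RCLike.norm_conj, norm_pow, Complex.norm_real, norm_of_nonneg hρ.le] at this
    nlinarith [norm_nonneg w]
  have h2 : 0 < ρ - ‖w‖ := by linarith
  calc ‖u‖ / ‖(ρ : ℂ) ^ 2 - (starRingEnd ℂ u) * w‖ ≤ ρ / (ρ * (ρ - ‖w‖)) := by gcongr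
    _ = (ρ - ‖w‖)⁻¹ := by field_simp

/-- A meromorphic function without zeros and poles on a circle is, in the disk, the product of
canonical factors and a zero-free function. -/
theorem exists_canonical_product {F : ℂ → ℂ} (hF : Meromorphic F)
    (hne : ∀ z, meromorphicOrderAt F z ≠ ⊤) {ρ : ℝ}
    (hs : ∀ z ∈ sphere (0 : ℂ) ρ, meromorphicOrderAt F z = 0) :
    ∃ h : ℂ → ℂ, AnalyticOnNhd ℂ h (closedBall 0 ρ) ∧ (∀ z ∈ closedBall (0 : ℂ) ρ, h z ≠ 0) ∧
      F =ᶠ[codiscreteWithin (closedBall 0 ρ)]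
        (∏ᶠ u, canonicalFactor ρ u ^ (-divisor F (ball 0 ρ) u)) * h := by
  obtain ⟨h, D⟩ := MeromorphicOn.exists_ecanonicalDecomp
    (hF.meromorphicOn (s := closedBall 0 ρ)) fun u => hne u
  refine ⟨h, D.analyticOnNhd, D.ne_zero, ?_⟩
  -- Without zeros or poles on the circle, the boundary factors of the decomposition are trivial.
  have hd : ∀ v, divisor F (sphere 0 ρ) v = 0 := by
    intro v
    by_cases hv : v ∈ sphere (0 : ℂ) ρ
    · rw [divisor_apply hF.meromorphicOn hv, hs v hv]
      simp
    · exact Function.locallyFinsuppWithin.apply_eq_zero_of_notMem _ hv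
  have := D.eventuallyEq
  simpa [hd] using this

theorem norm_finprod_canonicalFactor_eq_one {ρ : ℝ} {D : ℂ → ℤ}
    (hsupp : ∀ u, D u ≠ 0 → u ∈ ball (0 : ℂ) ρ) (hfin : (Function.support D).Finite) {z : ℂ}
    (hz : z ∈ sphere (0 : ℂ) ρ) :
    ‖(∏ᶠ u, canonicalFactor ρ u ^ (-D u)) z‖ = 1 := by
  rw [finprod_eq_prod_of_mulSupport_subset (s := hfin.toFinset)]
  · rw [Finset.prod_apply, norm_prod]
    refine Finset.prod_eq_one fun u hu => ?_
    rw [Pi.pow_apply, norm_zpow,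
      norm_canonicalFactor_eval_circle_eq_one (hsupp u (by simpa using hu)) hz, one_zpow]
  · intro u hu
    simp only [Set.Finite.coe_toFinset, Function.mem_support]
    rintro h0
    exact hu (by simp [h0])

theorem circleAverage_abs_log_norm {F : ℂ → ℂ} (hF : Meromorphic F) (ρ : ℝ) :
    circleAverage (fun z => |log ‖F z‖|) 0 ρ
      = ValueDistribution.proximity F ⊤ ρ + ValueDistribution.proximity F⁻¹ ⊤ ρ := by
  rw [ValueDistribution.proximity_top, ValueDistribution.proximity_top, ← circleAverage_fun_add]
  · congr 1
    ext z
    rw [Pi.inv_apply, norm_inv, ← half_mul_log_add_log_abs, ← half_mul_log_add_log_abs, log_inv,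
      abs_neg]
    ring
  · exact hF.meromorphicOn.circleIntegrable_posLog_norm
  · exact hF.inv.meromorphicOn.circleIntegrable_posLog_norm

/-- The canonical factors have modulus one on the circle of radius `ρ`, so `h` and `F` have the same
mean of `|log ‖·‖|` there. Inside, each zero or pole contributes one term, weighted by its
multiplicity. -/
theorem norm_logDeriv_le_codiscreteWithin {F : ℂ → ℂ} (hF : Meromorphic F)
    (hne : ∀ z, meromorphicOrderAt F z ≠ ⊤) {R ρ : ℝ} (hR : 0 < R) (hRρ : R < ρ)
    (hs : ∀ z ∈ sphere (0 : ℂ) ρ, meromorphicOrderAt F z = 0) :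
    ∀ᶠ w in codiscreteWithin (sphere (0 : ℂ) R), ‖logDeriv F w‖ ≤
      2 * ρ / (ρ - R) ^ 2 *
        (ValueDistribution.proximity F ⊤ ρ + ValueDistribution.proximity F⁻¹ ⊤ ρ)
      + ∑ᶠ u, |(divisor F (ball 0 ρ) u : ℝ)| * (‖w - u‖⁻¹ + (ρ - R)⁻¹) := by
  obtain ⟨h, hh, hh0, heq⟩ := exists_canonical_product hF hne hs
  have hρ : 0 < ρ := hR.trans hRρ
  set D : ℂ → ℤ := ⇑(divisor F (ball 0 ρ)) with hD
  have hfin : (Function.support D).Finite :=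
    (hF.meromorphicOn (s := closedBall 0 ρ)).divisor_ball_support_finite
  have hsupp : ∀ u, D u ≠ 0 → u ∈ ball (0 : ℂ) ρ := fun u hu =>
    (divisor F (ball 0 ρ)).supportWithinDomain hu
  set P : ℂ → ℂ := ∏ᶠ u, canonicalFactor ρ u ^ (-D u) with hP
  have hPm : Meromorphic P := by
    intro z
    exact MeromorphicAt.finprod fun u => (meromorphic_canonicalFactor ρ u z).zpow _
  have hP0 : ∀ z, meromorphicOrderAt P z ≠ ⊤ := by
    intro z
    refine meromorphicOrderAt_finprod_ne_top
      (fun u => (meromorphic_canonicalFactor ρ u z).zpow _) fun u => ?_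
    rw [meromorphicOrderAt_zpow (meromorphic_canonicalFactor ρ u z)]
    generalize -D u = m
    lift meromorphicOrderAt (canonicalFactor ρ u) z to ℤ using
      meromorphicOrderAt_canonicalFactor_ne_top u hρ with ℓ
    simp [← WithTop.coe_mul]
  -- the mean of `|log ‖h‖|`
  have hmean : circleAverage (fun z => |log ‖h z‖|) 0 ρ
      = ValueDistribution.proximity F ⊤ ρ + ValueDistribution.proximity F⁻¹ ⊤ ρ := by
    rw [← circleAverage_abs_log_norm hF]
    refine circleAverage_congr_codiscreteWithin ?_ hρ.ne'
    rw [abs_of_pos hρ]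
    filter_upwards [codiscreteWithin_mono sphere_subset_closedBall heq,
      self_mem_codiscreteWithin (sphere (0 : ℂ) ρ)] with z hz hzs
    rw [hz, Pi.mul_apply, norm_mul, norm_finprod_canonicalFactor_eq_one hsupp hfin hzs, one_mul]
  -- pass to logarithmic derivatives
  have hsub : ball (0 : ℂ) ρ ⊆ closedBall 0 ρ := ball_subset_closedBall
  have hhm : MeromorphicOn h (ball 0 ρ) := fun z hz => (hh z (hsub hz)).meromorphicAt
  have hh0' : ∀ z ∈ ball (0 : ℂ) ρ, meromorphicOrderAt h z ≠ ⊤ := fun z hz => by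
    rw [(hh z (hsub hz)).meromorphicNFAt.meromorphicOrderAt_eq_zero_iff.2 (hh0 z (hsub hz))]
    simp
  have h1 := logDeriv_congr_codiscreteWithin isOpen_ball (codiscreteWithin_mono hsub heq)
  have h2 := (hPm.meromorphicOn (s := ball 0 ρ)).logDeriv_mul_eventuallyEq hhm
    (fun z _ => hP0 z) hh0'
  have h3 : logDeriv P =ᶠ[codiscreteWithin (ball 0 ρ)]
      fun z => ∑ᶠ u, (-D u) • logDeriv (canonicalFactor ρ u) z := by
    refine MeromorphicOn.logDeriv_finprod_zpow_eventuallyEq (d := fun u => -D u) ?_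
      (fun u => (meromorphic_canonicalFactor ρ u).meromorphicOn)
      (fun u z _ => meromorphicOrderAt_canonicalFactor_ne_top u hρ)
    simpa using hfin
  have h4 : ∀ᶠ w in codiscreteWithin (ball (0 : ℂ) ρ), w ∉ Function.support D :=
    codiscreteWithin_mono (Set.subset_univ _) hfin.compl_mem_codiscrete
  have hsph : sphere (0 : ℂ) R ⊆ ball 0 ρ := fun z hz => by
    rw [mem_sphere_zero_iff_norm] at hz
    rw [mem_ball_zero_iff, hz]
    exact hRρ
  filter_upwards [codiscreteWithin_mono hsph h1, codiscreteWithin_mono hsph h2,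
    codiscreteWithin_mono hsph h3, codiscreteWithin_mono hsph h4,
    self_mem_codiscreteWithin (sphere (0 : ℂ) R)] with w hw1 hw2 hw3 hw4 hwR
  have hwb := hsph hwR
  rw [mem_sphere_zero_iff_norm] at hwR
  rw [hw1, hw2, Pi.add_apply, add_comm]
  refine (norm_add_le _ _).trans (add_le_add ?_ ?_)
  · have := norm_logDeriv_le_circleAverage hh hh0 hwb
    rwa [hmean, hwR] at this
  · rw [hw3, finsum_eq_sum_of_support_subset (s := hfin.toFinset),
      finsum_eq_sum_of_support_subset (s := hfin.toFinset)]
    · refine (norm_sum_le _ _).trans (Finset.sum_le_sum fun u hu => ?_)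
      have hu' : D u ≠ 0 := by simpa using hu
      have hwu : w ≠ u := by
        rintro rfl
        exact hw4 hu'
      rw [zsmul_eq_mul, norm_mul, Complex.norm_intCast]
      push_cast
      rw [abs_neg]
      gcongr
      rw [← hwR]
      exact norm_logDeriv_canonicalFactor_le (hsupp u hu') hwb hwu
    · intro u hu
      simp only [Set.Finite.coe_toFinset, Function.mem_support]
      intro h0
      exact hu (by simp [h0])
    · intro u hu
      simp only [Set.Finite.coe_toFinset, Function.mem_support]
      intro h0
      exact hu (by simp [h0])

/-- The square root turns the nonintegrable singularity `‖w - u‖⁻¹` on the circle into the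
integrable `‖w - u‖ ^ (-1/2)`. -/
theorem posLog_le_two_mul_log_one_add_sqrt {x : ℝ} (hx : 0 ≤ x) :
    log⁺ x ≤ 2 * log (1 + √x) := by
  have h0 : 0 ≤ √x := sqrt_nonneg x
  have h : log⁺ x ≤ log (1 + x) := by
    rw [posLog_def]
    refine max_le (log_nonneg (by linarith)) ?_
    rcases hx.eq_or_lt with h | h
    · simp [← h]
    · exact log_le_log h (by linarith)
  refine h.trans ?_
  rw [← Real.log_rpow (by linarith)]
  refine log_le_log (by linarith) ?_
  norm_cast
  nlinarith [sq_sqrt hx]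

/-- The tangent line of `log` at `B`. Averaged with `B` at least the mean of `y`, it replaces
Jensen's inequality. -/
theorem log_le_log_add_div_sub_one {y B : ℝ} (hy : 0 < y) (hB : 0 < B) :
    log y ≤ log B + y / B - 1 := by
  have := log_le_sub_one_of_pos (div_pos hy hB)
  rw [log_div hy.ne' hB.ne'] at this
  linarith

end NevanlinnaNear

/-! ### Averaging the logarithmic derivative through square roots -/

namespace NevanlinnaNear

open Real MeasureTheory Metric MeromorphicOn

theorem sqrt_add_le {a b : ℝ} (ha : 0 ≤ a) (hb : 0 ≤ b) : √(a + b) ≤ √a + √b := by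
  rw [Real.sqrt_le_iff]
  refine ⟨by positivity, ?_⟩
  nlinarith [sq_sqrt ha, sq_sqrt hb, mul_nonneg (sqrt_nonneg a) (sqrt_nonneg b)]

theorem sqrt_sum_le {ι : Type*} (S : Finset ι) {a : ι → ℝ} (ha : ∀ i ∈ S, 0 ≤ a i) :
    √(∑ i ∈ S, a i) ≤ ∑ i ∈ S, √(a i) := by
  classical
  induction S using Finset.induction_on with
  | empty => simp
  | insert i S hi ih =>
    rw [Finset.sum_insert hi, Finset.sum_insert hi]
    have h1 := ih fun j hj => ha j (Finset.mem_insert_of_mem hj)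
    have h2 := sqrt_add_le (ha i (Finset.mem_insert_self i S))
      (Finset.sum_nonneg fun j hj => ha j (Finset.mem_insert_of_mem hj))
    linarith

/-- A multiplicity is a natural number, so `√d ≤ d` and the sum stays linear in the multiplicities.
-/
theorem sqrt_natCast_mul_le {d x y : ℝ} (n : ℕ) (hd : d = n) (hx : 0 ≤ x) (hy : 0 ≤ y)
    (hy1 : y ≤ 1) : √(d * (x⁻¹ + y)) ≤ d * (x ^ (-(1 / 2) : ℝ) + 1) := by
  have h1 : √d ≤ d := by
    rw [hd, Real.sqrt_le_iff]
    refine ⟨by positivity, ?_⟩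
    exact_mod_cast Nat.le_self_pow two_ne_zero n
  have h2 : x ^ (-(1 / 2) : ℝ) = √(x⁻¹) := by
    rw [sqrt_eq_rpow, rpow_neg hx, inv_rpow hx]
  have h3 := sqrt_add_le (inv_nonneg.2 hx) hy
  have h4 : √y ≤ 1 := Real.sqrt_le_one.2 hy1
  have hd0 : 0 ≤ d := by rw [hd]; positivity
  rw [Real.sqrt_mul hd0, h2]
  gcongr
  linarith

theorem exists_proximity_logDeriv_le_log :
    ∃ K : ℝ, 0 ≤ K ∧ ∀ F : ℂ → ℂ, Meromorphic F → (∀ z, meromorphicOrderAt F z ≠ ⊤) →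
      ∀ R ρ : ℝ, 1 ≤ R → R + 1 ≤ ρ → (∀ z ∈ sphere (0 : ℂ) ρ, meromorphicOrderAt F z = 0) →
      ValueDistribution.proximity (logDeriv F) ⊤ R ≤ 2 * log (2 + 2 * ρ / (ρ - R) ^ 2 *
        (ValueDistribution.proximity F ⊤ ρ + ValueDistribution.proximity F⁻¹ ⊤ ρ)
        + (K + 1) * ∑ᶠ u, |(divisor F (ball 0 ρ) u : ℝ)|) := by
  obtain ⟨K, hK, havg⟩ := exists_circleAverage_norm_sub_rpow_le
  refine ⟨K, hK, fun F hF hne R ρ hR hRρ hs => ?_⟩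
  have hR0 : 0 < R := by linarith
  have hρ : 0 < ρ := by linarith
  have hmem := norm_logDeriv_le_codiscreteWithin hF hne hR0 (by linarith) hs
  set M : ℝ := 2 * ρ / (ρ - R) ^ 2 *
        (ValueDistribution.proximity F ⊤ ρ + ValueDistribution.proximity F⁻¹ ⊤ ρ) with hM
  have hM0 : 0 ≤ M := by
    have h1 := ValueDistribution.proximity_nonneg (f := F) (a := ⊤) ρ
    have h2 := ValueDistribution.proximity_nonneg (f := F⁻¹) (a := ⊤) ρ
    simp only [Pi.zero_apply] at h1 h2
    positivity
  set D : ℂ → ℤ := ⇑(divisor F (ball 0 ρ)) with hD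
  have hfin : (Function.support D).Finite :=
    (hF.meromorphicOn (s := closedBall 0 ρ)).divisor_ball_support_finite
  set S := hfin.toFinset with hS
  have hsum : ∀ φ : ℂ → ℝ, ∑ᶠ u, |(D u : ℝ)| * φ u = ∑ u ∈ S, |(D u : ℝ)| * φ u := by
    intro φ
    refine finsum_eq_sum_of_support_subset _ ?_
    intro u hu
    simp only [hS, Set.Finite.coe_toFinset, Function.mem_support]
    intro h0
    exact hu (by simp [h0])
  have hsum1 : ∑ᶠ u, |(D u : ℝ)| = ∑ u ∈ S, |(D u : ℝ)| := by
    simpa using hsum fun _ => 1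
  rw [hsum1]
  set n : ℝ := ∑ u ∈ S, |(D u : ℝ)| with hn
  have hn0 : 0 ≤ n := Finset.sum_nonneg fun u _ => abs_nonneg _
  -- `B` bounds the mean of `Y` below. The `2` collects the `1` in `1 + √` and that in `√M ≤ 1 + M`;
  -- each zero or pole costs `K` for the singular term and `1` for `√((ρ - R)⁻¹)`.
  set B : ℝ := 2 + M + (K + 1) * n with hB
  have hB0 : 0 < B := by positivity
  set Y : ℂ → ℝ := fun w => 2 + M + ∑ u ∈ S, |(D u : ℝ)| * (‖w - u‖ ^ (-(1 / 2) : ℝ) + 1) with hY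
  have hY0 : ∀ w, 0 < Y w := fun w => by
    have : 0 ≤ ∑ u ∈ S, |(D u : ℝ)| * (‖w - u‖ ^ (-(1 / 2) : ℝ) + 1) :=
      Finset.sum_nonneg fun u _ => by positivity
    simp only [hY]
    linarith
  have hint1 : ∀ u ∈ S, CircleIntegrable
      (fun w => |(D u : ℝ)| * (‖w - u‖ ^ (-(1 / 2) : ℝ) + 1)) 0 R := fun u _ =>
    ((circleIntegrable_norm_sub_rpow hR u).add (circleIntegrable_const 1 0 R)).const_smul
      (a := |(D u : ℝ)|)
  have hint2 : CircleIntegrable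
      (fun w => ∑ u ∈ S, |(D u : ℝ)| * (‖w - u‖ ^ (-(1 / 2) : ℝ) + 1)) 0 R :=
    CircleIntegrable.fun_sum S hint1
  have hYint : CircleIntegrable Y 0 R := (circleIntegrable_const (2 + M) 0 R).add hint2
  have hYavg : circleAverage Y 0 R ≤ B := by
    rw [hY, circleAverage_fun_add (circleIntegrable_const _ _ _) hint2, circleAverage_const,
      circleAverage_fun_sum hint1, hB, hn, Finset.mul_sum]
    gcongr with u hu
    rw [show (fun w : ℂ => |(D u : ℝ)| * (‖w - u‖ ^ (-(1 / 2) : ℝ) + 1))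
      = fun w => |(D u : ℝ)| • (‖w - u‖ ^ (-(1 / 2) : ℝ) + 1) from rfl, circleAverage_fun_smul,
      circleAverage_fun_add (circleIntegrable_norm_sub_rpow hR u) (circleIntegrable_const _ _ _),
      circleAverage_const, smul_eq_mul, mul_comm]
    gcongr
    exact havg R hR u
  -- pointwise estimate
  have hpt : ∀ᶠ w in codiscreteWithin (sphere (0 : ℂ) |R|),
      log⁺ ‖logDeriv F w‖ ≤ 2 * (log B - 1) + 2 / B * Y w := by
    rw [abs_of_pos hR0]
    filter_upwards [hmem] with w hw
    rw [hsum] at hw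
    have hsq : 1 + √‖logDeriv F w‖ ≤ Y w := by
      have h1 : √(∑ u ∈ S, |(D u : ℝ)| * (‖w - u‖⁻¹ + (ρ - R)⁻¹))
          ≤ ∑ u ∈ S, |(D u : ℝ)| * (‖w - u‖ ^ (-(1 / 2) : ℝ) + 1) := by
        refine (sqrt_sum_le S fun u _ => by
          have : 0 < ρ - R := by linarith
          positivity).trans (Finset.sum_le_sum fun u _ => ?_)
        refine sqrt_natCast_mul_le (D u).natAbs (by simp [Nat.cast_natAbs]) (norm_nonneg _) ?_ ?_
        · exact inv_nonneg.2 (by linarith)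
        · exact inv_le_one_of_one_le₀ (by linarith)
      have h2 : √M ≤ 1 + M := by
        rw [Real.sqrt_le_left (by linarith)]
        nlinarith
      have h3 := (Real.sqrt_le_sqrt hw).trans (sqrt_add_le hM0 (Finset.sum_nonneg fun u _ => by
        have : 0 < ρ - R := by linarith
        positivity))
      simp only [hY]
      linarith
    refine (posLog_le_two_mul_log_one_add_sqrt (norm_nonneg _)).trans ?_
    have h4 : log (1 + √‖logDeriv F w‖) ≤ log (Y w) := log_le_log (by positivity) hsq
    have h5 := log_le_log_add_div_sub_one (hY0 w) hB0
    have h6 : 2 / B * Y w = 2 * (Y w / B) := by ring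
    rw [h6]
    linarith
  rw [ValueDistribution.proximity_top]
  have hint3 : CircleIntegrable (fun w => 2 / B * Y w) 0 R := hYint.const_smul (a := 2 / B)
  refine (circleAverage_le_of_le_codiscreteWithin hR0.ne'
    hF.logDeriv.meromorphicOn.circleIntegrable_posLog_norm
    ((circleIntegrable_const _ _ _).add hint3) hpt).trans ?_
  rw [circleAverage_add (circleIntegrable_const _ _ _) hint3, circleAverage_const,
    show (fun w : ℂ => 2 / B * Y w) = fun w => (2 / B) • Y w from rfl, circleAverage_fun_smul,
    smul_eq_mul]
  have : 2 / B * circleAverage Y 0 R ≤ 2 / B * B := by gcongr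
  rw [div_mul_cancel₀ _ hB0.ne'] at this
  linarith

end NevanlinnaNear

/-! ### Counting zeros and poles, and the choice of the outer radius -/

namespace NevanlinnaNear

open Real MeasureTheory Metric MeromorphicOn

/-- By the convention `log 0 = 0` the term at `u = 0` is `E 0 * log r`, as the counting function
requires. -/
theorem logCounting_eq_finsum (E : Function.locallyFinsupp ℂ ℤ) {r : ℝ} (hr : r ≠ 0) :
    Function.locallyFinsuppWithin.logCounting E r
      = ∑ᶠ u, (E.toClosedBall r u : ℝ) * (log r - log ‖u‖) := by
  have hfin : (Function.support ⇑(E.toClosedBall r)).Finite :=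
    (E.toClosedBall r).finiteSupport (isCompact_closedBall _ _)
  have h := countingFunction_finsum_eq_finsum_add (c := 0) hr hfin
  simp only [zero_sub, norm_neg] at h
  rw [h, Function.locallyFinsuppWithin.toClosedBall_eval_within E (by simp)]
  rfl

theorem posPart_add_negPart_apply (D : Function.locallyFinsupp ℂ ℤ) (u : ℂ) :
    (D⁺ + D⁻) u = |D u| :=
  posPart_add_negPart (D u)

/-- A zero or pole `u` with `‖u‖ < ρ` enters the counting functions at `2 * ρ` with weight `log (2 *
ρ / ‖u‖) ≥ log 2`. At `u = 0` the weight is `log (2 * ρ)`, which is why `1 ≤ ρ` is assumed. -/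
theorem log_two_mul_finsum_abs_divisor_le {F : ℂ → ℂ} (hF : Meromorphic F) {ρ : ℝ} (hρ : 1 ≤ ρ) :
    log 2 * ∑ᶠ u, |(divisor F (ball 0 ρ) u : ℝ)| ≤
      ValueDistribution.logCounting F 0 (2 * ρ) + ValueDistribution.logCounting F ⊤ (2 * ρ) := by
  rw [ValueDistribution.logCounting_zero, ValueDistribution.logCounting_top, ← Pi.add_apply,
    ← map_add, logCounting_eq_finsum _ (by positivity)]
  set D := divisor F Set.univ with hD
  set E : Function.locallyFinsupp ℂ ℤ := D⁺ + D⁻ with hE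
  have hEv : ∀ u, E u = |D u| := posPart_add_negPart_apply D
  have hfin1 : (Function.support ⇑(E.toClosedBall (2 * ρ))).Finite :=
    (E.toClosedBall (2 * ρ)).finiteSupport (isCompact_closedBall _ _)
  have hball : ∀ u ∈ ball (0 : ℂ) ρ, |(divisor F (ball 0 ρ) u : ℝ)| = E.toClosedBall (2 * ρ) u := by
    intro u hu
    rw [mem_ball_zero_iff] at hu
    rw [Function.locallyFinsuppWithin.toClosedBall_eval_within, hEv,
      divisor_apply hF.meromorphicOn (mem_ball_zero_iff.2 hu), hD,
      divisor_apply hF.meromorphicOn (Set.mem_univ u)]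
    · simp
    · rw [mem_closedBall_zero_iff, abs_of_pos (by linarith)]
      linarith
  have hnn : ∀ u, (0 : ℝ) ≤ E.toClosedBall (2 * ρ) u := by
    intro u
    by_cases hu : u ∈ closedBall (0 : ℂ) |2 * ρ|
    · rw [Function.locallyFinsuppWithin.toClosedBall_eval_within _ hu, hEv]
      positivity
    · rw [Function.locallyFinsuppWithin.apply_eq_zero_of_notMem _ hu]
      simp
  have hsub : Function.support (fun u => |(divisor F (ball 0 ρ) u : ℝ)|)
      ⊆ Function.support ⇑(E.toClosedBall (2 * ρ)) := by
    intro u hu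
    by_cases hub : u ∈ ball (0 : ℂ) ρ
    · rw [Function.mem_support, hball u hub] at hu
      exact_mod_cast hu
    · exact absurd (by simp [Function.locallyFinsuppWithin.apply_eq_zero_of_notMem _ hub]) hu
  rw [finsum_eq_sum_of_support_subset (s := hfin1.toFinset) _ (by simpa using hsub),
    finsum_eq_sum_of_support_subset (s := hfin1.toFinset), Finset.mul_sum]
  · refine Finset.sum_le_sum fun u hu => ?_
    by_cases hub : u ∈ ball (0 : ℂ) ρ
    · rw [hball u hub, mul_comm]
      refine mul_le_mul_of_nonneg_left ?_ (hnn u)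
      rw [mem_ball_zero_iff] at hub
      rw [log_mul two_ne_zero (by positivity)]
      rcases eq_or_ne u 0 with rfl | h0
      · simpa using log_nonneg hρ
      · have := log_le_log (norm_pos_iff.2 h0) hub.le
        linarith
    · rw [Function.locallyFinsuppWithin.apply_eq_zero_of_notMem _ hub]
      simp only [Int.cast_zero, abs_zero, mul_zero]
      by_cases huc : u ∈ closedBall (0 : ℂ) |2 * ρ|
      · refine mul_nonneg (hnn u) ?_
        rw [mem_closedBall_zero_iff, abs_of_pos (by linarith)] at huc
        rcases eq_or_ne u 0 with rfl | h0
        · simpa using log_nonneg (by linarith)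
        · exact sub_nonneg.2 (log_le_log (norm_pos_iff.2 h0) huc)
      · rw [Function.locallyFinsuppWithin.apply_eq_zero_of_notMem _ huc]
        simp
  · intro u hu
    simp only [Set.Finite.coe_toFinset, Function.mem_support]
    intro h0
    exact hu (by simp [h0])

/-- Only finitely many zeros and poles lie in a closed disk, so only finitely many radii are
forbidden. -/
theorem exists_radius_forall_order_eq_zero {F : ℂ → ℂ} (hF : Meromorphic F)
    (hne : ∀ z, meromorphicOrderAt F z ≠ ⊤) {a b : ℝ} (hab : a < b) :
    ∃ ρ ∈ Set.Ioo a b, ∀ z ∈ sphere (0 : ℂ) ρ, meromorphicOrderAt F z = 0 := by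
  have hfin : (Function.support ⇑(divisor F (closedBall (0 : ℂ) b))).Finite :=
    (divisor F (closedBall (0 : ℂ) b)).finiteSupport (isCompact_closedBall _ _)
  obtain ⟨ρ, hρ, hρ'⟩ := ((Set.Ioo_infinite hab).sdiff (hfin.image norm)).nonempty
  refine ⟨ρ, hρ, fun z hz => ?_⟩
  rw [mem_sphere_zero_iff_norm] at hz
  by_contra h
  refine hρ' ⟨z, ?_, hz⟩
  rw [Function.mem_support, divisor_apply hF.meromorphicOn
    (mem_closedBall_zero_iff.2 (hz.trans_le hρ.2.le))]
  simp [WithTop.untop₀_eq_zero, h, hne z]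

theorem characteristic_inv_le {F : ℂ → ℂ} (hF : Meromorphic F) :
    ∃ C, 0 ≤ C ∧ ∀ R, 1 ≤ R → ValueDistribution.characteristic F⁻¹ ⊤ R
      ≤ ValueDistribution.characteristic F ⊤ R + C := by
  refine ⟨|log ‖meromorphicTrailingCoeffAt F 0‖|, abs_nonneg _, fun R hR => ?_⟩
  have := ValueDistribution.characteristic_sub_characteristic_inv_of_ne_zero hF
    (by linarith : R ≠ 0)
  have h2 := neg_abs_le (log ‖meromorphicTrailingCoeffAt F 0‖)
  linarith

theorem proximity_le_characteristic (F : ℂ → ℂ) {R : ℝ} (hR : 1 ≤ R) :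
    ValueDistribution.proximity F ⊤ R ≤ ValueDistribution.characteristic F ⊤ R := by
  have := ValueDistribution.logCounting_nonneg (f := F) (e := ⊤) hR
  simp only [ValueDistribution.characteristic, Pi.add_apply]
  linarith

theorem logCounting_le_characteristic (F : ℂ → ℂ) (R : ℝ) :
    ValueDistribution.logCounting F ⊤ R ≤ ValueDistribution.characteristic F ⊤ R := by
  have := ValueDistribution.proximity_nonneg (f := F) (a := ⊤) R
  simp only [ValueDistribution.characteristic, Pi.add_apply, Pi.zero_apply] at *
  linarith

theorem characteristic_congr {F G : ℂ → ℂ} (h : F =ᶠ[codiscrete ℂ] G) {R : ℝ} (hR : 1 ≤ R) :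
    ValueDistribution.characteristic F ⊤ R = ValueDistribution.characteristic G ⊤ R :=
  ValueDistribution.characteristic_congr_codiscrete h (by linarith)

theorem eventually_codiscrete_iff {p : ℂ → Prop} :
    (∀ᶠ z in codiscrete ℂ, p z) ↔ ∀ x, ∀ᶠ z in 𝓝[≠] x, p z := by
  rw [Filter.Eventually, mem_codiscrete]
  simp only [disjoint_principal_right, compl_compl]
  rfl

theorem eventuallyEq_zero_of_order_eq_top {F : ℂ → ℂ} (hF : Meromorphic F) {z : ℂ}
    (h : meromorphicOrderAt F z = ⊤) : F =ᶠ[codiscrete ℂ] 0 := by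
  have hall : ∀ u, meromorphicOrderAt F u = ⊤ := by
    by_contra hc
    push Not at hc
    exact hF.exists_meromorphicOrderAt_ne_top_iff_forall.1 hc z h
  exact eventually_codiscrete_iff.2 fun x => meromorphicOrderAt_eq_top_iff.1 (hall x)

/-- **Lemma on the logarithmic derivative**, with an enlarged radius in place of an exceptional
set. -/
theorem exists_proximity_logDeriv_le {F : ℂ → ℂ} (hF : Meromorphic F) :
    ∃ C, 0 ≤ C ∧ ∀ R, 1 ≤ R → ValueDistribution.proximity (logDeriv F) ⊤ R
      ≤ C + 2 * log⁺ (ValueDistribution.characteristic F ⊤ (6 * R)) := by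
  by_cases hne : ∀ z, meromorphicOrderAt F z ≠ ⊤
  swap
  · push Not at hne
    obtain ⟨z, hz⟩ := hne
    have h0 : logDeriv F =ᶠ[codiscrete ℂ] fun _ => 0 := by
      have := logDeriv_congr_codiscrete (eventuallyEq_zero_of_order_eq_top hF hz)
      rwa [show (0 : ℂ → ℂ) = fun _ => 0 from rfl, logDeriv_const] at this
    refine ⟨0, le_rfl, fun R hR => ?_⟩
    rw [ValueDistribution.proximity_congr_codiscrete h0 (by linarith),
      ValueDistribution.proximity_const]
    have := posLog_nonneg (x := ValueDistribution.characteristic F ⊤ (6 * R))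
    simp only [norm_zero, posLog_zero]
    linarith
  obtain ⟨K, hK, hmain⟩ := exists_proximity_logDeriv_le_log
  obtain ⟨C, hC, hinv⟩ := characteristic_inv_le hF
  -- The `6` bounds `2 * ρ / (ρ - R) ^ 2` for `2 * R < ρ < 3 * R`. The factor `2 + C` comes from
  -- adding the characteristics of `F` and `F⁻¹`.
  set A : ℝ := 2 + 6 * (2 + C) + (K + 1) * ((2 + C) / log 2) with hA
  have hl2 : 0 < log 2 := log_pos (by norm_num)
  have hA1 : 1 ≤ A := by
    have : 0 ≤ (K + 1) * ((2 + C) / log 2) := by positivity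
    linarith
  refine ⟨2 * (log A + log 2), by have := log_nonneg hA1; positivity, fun R hR => ?_⟩
  -- The lower bound gives `ρ - R > R ≥ 1`; the upper one keeps `2 * ρ`, where zeros and poles are
  -- counted, below `6 * R`.
  obtain ⟨ρ, ⟨hρ1, hρ2⟩, hs⟩ := exists_radius_forall_order_eq_zero hF hne
    (by linarith : 2 * R < 3 * R)
  refine (hmain F hF hne R ρ hR (by linarith) hs).trans ?_
  set T := ValueDistribution.characteristic F ⊤ (6 * R) with hT
  have hT0 : 0 ≤ T := ValueDistribution.characteristic_nonneg (by linarith)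
  have hmono : ∀ x, 1 ≤ x → x ≤ 6 * R → ValueDistribution.characteristic F ⊤ x ≤ T :=
    fun x hx1 hx2 => ValueDistribution.characteristic_monotoneOn hF
      (Set.mem_Ioi.2 (by linarith)) (Set.mem_Ioi.2 (by linarith)) hx2
  have h1 : ValueDistribution.proximity F ⊤ ρ + ValueDistribution.proximity F⁻¹ ⊤ ρ
      ≤ (2 + C) * (1 + T) := by
    have a1 := proximity_le_characteristic F (by linarith : 1 ≤ ρ)
    have a2 := proximity_le_characteristic F⁻¹ (by linarith : 1 ≤ ρ)
    have a3 := hinv ρ (by linarith)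
    have a4 := hmono ρ (by linarith) (by linarith)
    nlinarith
  have h2 : ∑ᶠ u, |(divisor F (ball 0 ρ) u : ℝ)| ≤ (2 + C) / log 2 * (1 + T) := by
    have a1 := log_two_mul_finsum_abs_divisor_le hF (by linarith : 1 ≤ ρ)
    have a2 := logCounting_le_characteristic F (2 * ρ)
    have a3 := logCounting_le_characteristic F⁻¹ (2 * ρ)
    rw [ValueDistribution.logCounting_inv] at a3
    have a4 := hinv (2 * ρ) (by linarith)
    have a5 := hmono (2 * ρ) (by linarith) (by linarith)
    rw [div_mul_eq_mul_div, le_div_iff₀ hl2, mul_comm]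
    nlinarith
  have h3 : 2 * ρ / (ρ - R) ^ 2 ≤ 6 := by
    rw [div_le_iff₀ (by nlinarith)]
    nlinarith
  have hp : 0 ≤ ValueDistribution.proximity F ⊤ ρ + ValueDistribution.proximity F⁻¹ ⊤ ρ :=
    add_nonneg (ValueDistribution.proximity_nonneg ρ) (ValueDistribution.proximity_nonneg ρ)
  have hfs : 0 ≤ ∑ᶠ u, |(divisor F (ball 0 ρ) u : ℝ)| := finsum_nonneg fun u => abs_nonneg _
  have h4 : 2 + 2 * ρ / (ρ - R) ^ 2 *
        (ValueDistribution.proximity F ⊤ ρ + ValueDistribution.proximity F⁻¹ ⊤ ρ)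
        + (K + 1) * ∑ᶠ u, |(divisor F (ball 0 ρ) u : ℝ)| ≤ A * (1 + T) := by
    have b1 : 2 * ρ / (ρ - R) ^ 2 *
        (ValueDistribution.proximity F ⊤ ρ + ValueDistribution.proximity F⁻¹ ⊤ ρ)
        ≤ 6 * ((2 + C) * (1 + T)) := by gcongr
    have b2 : (K + 1) * ∑ᶠ u, |(divisor F (ball 0 ρ) u : ℝ)|
      ≤ (K + 1) * ((2 + C) / log 2 * (1 + T)) := by gcongr
    have b3 : A * (1 + T) = 2 * (1 + T) + 6 * ((2 + C) * (1 + T))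
        + (K + 1) * ((2 + C) / log 2 * (1 + T)) := by rw [hA]; ring
    linarith
  have h5 : log (1 + T) ≤ log 2 + log⁺ T := by
    have := posLog_add (x := 1) (y := T)
    rw [posLog_one, posLog_eq_log (by rw [abs_of_nonneg] <;> linarith)] at this
    linarith
  have h6 : 0 ≤ 2 * ρ / (ρ - R) ^ 2 := by
    have : 0 < ρ := by linarith
    positivity
  have h7 := log_le_log (by positivity) h4
  rw [log_mul (by linarith) (by linarith)] at h7
  linarith

end NevanlinnaNear

namespace NevanlinnaNear

open Real Metric MeromorphicOn

/-! ### The operator `-w² d/dw`, that is, `d/dz` in the coordinate `w = 1 / (z - z₀)` -/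

/-- The derivation `d/dz` in the coordinate `w = 1 / (z - z₀)`. -/
noncomputable def invDeriv (G : ℂ → ℂ) : ℂ → ℂ := fun w => -w ^ 2 * deriv G w

theorem meromorphic_invDeriv {G : ℂ → ℂ} (hG : Meromorphic G) : Meromorphic (invDeriv G) := by
  have h : Meromorphic (fun w : ℂ => -w ^ 2) := fun w => by fun_prop
  exact h.mul hG.deriv

theorem meromorphic_invDeriv_iterate {F : ℂ → ℂ} (hF : Meromorphic F) (j : ℕ) :
    Meromorphic (invDeriv^[j] F) := by
  induction j with
  | zero => exact hF
  | succ j ih =>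
    rw [Function.iterate_succ_apply']
    exact meromorphic_invDeriv ih

theorem invDeriv_eventuallyEq {G : ℂ → ℂ} (hG : Meromorphic G) :
    invDeriv G =ᶠ[codiscrete ℂ] (fun w => -w ^ 2) * (logDeriv G * G) := by
  by_cases hne : ∀ z, meromorphicOrderAt G z ≠ ⊤
  · have := (hG.meromorphicOn (s := Set.univ)).eventually_codiscreteWithin_apply_ne_zero
      fun z _ => hne z
    filter_upwards [this] with w hw
    simp [invDeriv, logDeriv_apply, div_mul_cancel₀ _ hw]
  · push Not at hne
    obtain ⟨z, hz⟩ := hne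
    refine eventually_codiscrete_iff.2 fun x => ?_
    have h0 := eventually_codiscrete_iff.1 (eventuallyEq_zero_of_order_eq_top hG hz) x
    have h1 : deriv G =ᶠ[𝓝[≠] x] deriv 0 := Filter.EventuallyEq.nhdsNE_deriv h0
    filter_upwards [h0, h1] with w hw hw1
    simp [invDeriv, hw, hw1]

theorem proximity_neg_sq {R : ℝ} (hR : 1 ≤ R) :
    ValueDistribution.proximity (fun w : ℂ => -w ^ 2) ⊤ R = 2 * log R := by
  rw [ValueDistribution.proximity_top]
  refine circleAverage_const_on_circle fun z hz => ?_
  rw [mem_sphere_zero_iff_norm, abs_of_nonneg (by linarith)] at hz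
  rw [norm_neg, norm_pow, hz, posLog_pow, posLog_eq_log (by rw [abs_of_nonneg] <;> linarith)]
  norm_num

theorem characteristic_neg_sq {R : ℝ} (hR : 1 ≤ R) :
    ValueDistribution.characteristic (fun w : ℂ => -w ^ 2) ⊤ R = 2 * log R := by
  have h : ValueDistribution.logCounting (fun w : ℂ => -w ^ 2) ⊤ = 0 := by
    have := ValueDistribution.logCounting_add_analyticOn (f := (0 : ℂ → ℂ))
      (g := fun w : ℂ => -w ^ 2) (fun w => by
        change MeromorphicAt (fun _ => 0) w
        fun_prop) (fun w _ => AnalyticAt.analyticWithinAt (by fun_prop))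
    simpa using this
  rw [ValueDistribution.characteristic, Pi.add_apply, h, proximity_neg_sq hR]
  simp

/-- A logarithmic derivative has only simple poles, located at the zeros and poles of `G`. -/
theorem logCounting_logDeriv_le {G : ℂ → ℂ} (hG : Meromorphic G)
    (hne : ∀ z, meromorphicOrderAt G z ≠ ⊤) {R : ℝ} (hR : 1 ≤ R) :
    ValueDistribution.logCounting (logDeriv G) ⊤ R
      ≤ ValueDistribution.logCounting G 0 R + ValueDistribution.logCounting G ⊤ R := by
  rw [ValueDistribution.logCounting_zero, ValueDistribution.logCounting_top,
    ValueDistribution.logCounting_top, ← Pi.add_apply, ← map_add]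
  refine Function.locallyFinsuppWithin.logCounting_le (fun z => ?_) hR
  have h1 : divisor (logDeriv G) Set.univ z = (meromorphicOrderAt (logDeriv G) z).untop₀ :=
    divisor_apply hG.logDeriv.meromorphicOn (Set.mem_univ z)
  have h2 : divisor G Set.univ z = (meromorphicOrderAt G z).untop₀ :=
    divisor_apply hG.meromorphicOn (Set.mem_univ z)
  rw [posPart_add_negPart_apply, Function.locallyFinsuppWithin.negPart_apply, h1, h2]
  by_cases h0 : meromorphicOrderAt G z = 0
  · have := meromorphicOrderAt_logDeriv_nonneg (hG z) h0
    rw [h0]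
    simp [this]
  · rw [meromorphicOrderAt_logDeriv_eq_neg_one (hG z) h0 (hne z)]
    have h3 : (meromorphicOrderAt G z).untop₀ ≠ 0 := by
      simp [WithTop.untop₀_eq_zero, h0, hne z]
    have h4 := Int.one_le_abs h3
    simpa using h4

theorem exists_characteristic_invDeriv_le {G : ℂ → ℂ} (hG : Meromorphic G) :
    ∃ C, 1 ≤ C ∧ ∀ R, 1 ≤ R → ValueDistribution.characteristic (invDeriv G) ⊤ R
      ≤ C * (1 + log R + ValueDistribution.characteristic G ⊤ (6 * R)) := by
  -- The product inequalities for the characteristic need factors that do not vanish identically.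
  -- Nonvanishing of the product gives this for all three at once.
  by_cases hne : ∀ z, meromorphicOrderAt (invDeriv G) z ≠ ⊤
  swap
  · push Not at hne
    obtain ⟨z, hz⟩ := hne
    have h0 := eventuallyEq_zero_of_order_eq_top (meromorphic_invDeriv hG) hz
    refine ⟨1, le_rfl, fun R hR => ?_⟩
    rw [characteristic_congr h0 hR]
    have h1 : ValueDistribution.characteristic (0 : ℂ → ℂ) ⊤ R = 0 := by
      change ValueDistribution.characteristic (fun _ => (0 : ℂ)) ⊤ R = 0
      simp [ValueDistribution.characteristic]
    rw [h1]
    have := log_nonneg hR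
    have := ValueDistribution.characteristic_nonneg (f := G) (a := ⊤) (by linarith : 1 ≤ 6 * R)
    linarith
  have heq := invDeriv_eventuallyEq hG
  have hsqm : Meromorphic (fun w : ℂ => -w ^ 2) := fun w => by fun_prop
  have hord : ∀ z, meromorphicOrderAt (fun w : ℂ => -w ^ 2) z
      + (meromorphicOrderAt (logDeriv G) z + meromorphicOrderAt G z) ≠ ⊤ := by
    intro z
    rw [← meromorphicOrderAt_mul (hG z).logDeriv (hG z),
      ← meromorphicOrderAt_mul (hsqm z) ((hG z).logDeriv.mul (hG z)),
      ← meromorphicOrderAt_congr (eventually_codiscrete_iff.1 heq z)]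
    exact hne z
  simp only [ne_eq, WithTop.add_eq_top, not_or] at hord
  obtain ⟨C₁, hC₁, hm⟩ := exists_proximity_logDeriv_le hG
  obtain ⟨C₂, hC₂, hinv⟩ := characteristic_inv_le hG
  -- The `5` counts copies of `T`: two from `2 * log⁺ T`, one each from the zeros of `G`, the poles
  -- of `G`, and `G` itself.
  refine ⟨C₁ + C₂ + 5, by linarith, fun R hR => ?_⟩
  rw [characteristic_congr heq hR]
  have h1 := ValueDistribution.characteristic_mul_top_le hR hsqm (fun z => (hord z).1)
    (hG.logDeriv.mul hG) (fun z => by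
      rw [meromorphicOrderAt_mul (hG z).logDeriv (hG z)]
      simpa using (hord z).2)
  have h2 := ValueDistribution.characteristic_mul_top_le hR hG.logDeriv (fun z => (hord z).2.1)
    hG (fun z => (hord z).2.2)
  rw [Pi.add_apply] at h1 h2
  rw [characteristic_neg_sq hR] at h1
  have h3 : ValueDistribution.characteristic (logDeriv G) ⊤ R
      = ValueDistribution.proximity (logDeriv G) ⊤ R
        + ValueDistribution.logCounting (logDeriv G) ⊤ R := rfl
  have h4 := hm R hR
  have h5 := logCounting_logDeriv_le hG (fun z => (hord z).2.2) hR
  have h6 := logCounting_le_characteristic G R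
  have h7 := logCounting_le_characteristic G⁻¹ R
  rw [ValueDistribution.logCounting_inv] at h7
  have h8 := hinv R hR
  set T := ValueDistribution.characteristic G ⊤ (6 * R) with hT
  have h9 : ValueDistribution.characteristic G ⊤ R ≤ T :=
    ValueDistribution.characteristic_monotoneOn hG (Set.mem_Ioi.2 (by linarith))
      (Set.mem_Ioi.2 (by linarith)) (by linarith)
  have h10 : 0 ≤ T := ValueDistribution.characteristic_nonneg (by linarith)
  have h11 : log⁺ T ≤ T := by
    rw [posLog_apply]
    exact max_le h10 (log_le_self h10)
  have h12 := log_nonneg hR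
  nlinarith [mul_nonneg hC₁ h12, mul_nonneg hC₁ h10, mul_nonneg hC₂ h12, mul_nonneg hC₂ h10]

theorem exists_characteristic_invDeriv_iterate_le {F : ℂ → ℂ} (hF : Meromorphic F) (j : ℕ) :
    ∃ C, 1 ≤ C ∧ ∀ R, 1 ≤ R → ValueDistribution.characteristic (invDeriv^[j] F) ⊤ R
      ≤ C * (1 + log R + ValueDistribution.characteristic F ⊤ (6 ^ j * R)) := by
  induction j with
  | zero =>
    refine ⟨1, le_rfl, fun R hR => ?_⟩
    have := log_nonneg hR
    simp only [Function.iterate_zero, id_eq, pow_zero, one_mul]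
    linarith
  | succ j ih =>
    obtain ⟨C, hC, h⟩ := ih
    obtain ⟨C', hC', h'⟩ := exists_characteristic_invDeriv_le (meromorphic_invDeriv_iterate hF j)
    have hl6 : 0 ≤ log 6 := log_nonneg (by norm_num)
    refine ⟨C' * (1 + C * (1 + log 6)), by nlinarith [mul_nonneg (by linarith : 0 ≤ C) hl6],
      fun R hR => ?_⟩
    rw [Function.iterate_succ_apply']
    refine (h' R hR).trans ?_
    rw [mul_assoc]
    have h1 := h (6 * R) (by linarith)
    rw [log_mul (by norm_num) (by linarith), ← mul_assoc, ← pow_succ] at h1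
    have h2 := log_nonneg hR
    have h3 : 0 ≤ ValueDistribution.characteristic F ⊤ (6 ^ (j + 1) * R) :=
      ValueDistribution.characteristic_nonneg
        (one_le_mul_of_one_le_of_one_le (one_le_pow₀ (by norm_num)) hR)
    set T := ValueDistribution.characteristic F ⊤ (6 ^ (j + 1) * R)
    have hC0 : 0 ≤ C := by linarith
    refine mul_le_mul_of_nonneg_left ?_ (by linarith)
    nlinarith [mul_nonneg hC0 h2, mul_nonneg hC0 h3, mul_nonneg (mul_nonneg hC0 hl6) h2,
      mul_nonneg (mul_nonneg hC0 hl6) h3]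

/-- Telescoping: `D^(j+1) F / F` is `-w²` times the logarithmic derivative of `D^j F` times `D^j F /
F`. The characteristic of `D^j F` enters only under `log⁺`, so a crude linear bound for it suffices.
-/
theorem exists_proximity_invDeriv_iterate_div_le {F : ℂ → ℂ} (hF : Meromorphic F) (j : ℕ) :
    ∃ C, 0 ≤ C ∧ ∀ R, 1 ≤ R → ValueDistribution.proximity (invDeriv^[j] F / F) ⊤ R
      ≤ C * (1 + log R + log⁺ (ValueDistribution.characteristic F ⊤ (6 ^ j * R))) := by
  induction j with
  | zero =>
    refine ⟨0, le_rfl, fun R hR => ?_⟩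
    rw [ValueDistribution.proximity_top, zero_mul]
    refine (circleAverage_const_on_circle (a := 0) fun z _ => ?_).le
    rcases eq_or_ne (F z) 0 with h | h
    · simp [h]
    · simp [div_self h]
  | succ j ih =>
    obtain ⟨C, hC, h⟩ := ih
    have hG := meromorphic_invDeriv_iterate hF j
    obtain ⟨C₁, hC₁, hm⟩ := exists_proximity_logDeriv_le hG
    obtain ⟨C₂, hC₂, hT⟩ := exists_characteristic_invDeriv_iterate_le hF j
    have hl6 : 0 ≤ log 6 := log_nonneg (by norm_num)
    have hl2 : 0 ≤ log 2 := log_nonneg (by norm_num)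
    have hlC : 0 ≤ log C₂ := log_nonneg hC₂
    refine ⟨C + 2 + C₁ + 2 * (log C₂ + 2 * log 2 + log 6 + 1), by positivity, fun R hR => ?_⟩
    have hR1 : 0 ≤ log R := log_nonneg hR
    have heq : invDeriv^[j + 1] F / F =ᶠ[codiscrete ℂ]
        (fun w => -w ^ 2) * (logDeriv (invDeriv^[j] F) * (invDeriv^[j] F / F)) := by
      rw [Function.iterate_succ_apply']
      filter_upwards [invDeriv_eventuallyEq hG] with w hw
      simp only [Pi.div_apply, Pi.mul_apply] at hw ⊢
      rw [hw]
      ring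
    rw [ValueDistribution.proximity_congr_codiscrete heq (by linarith)]
    have h1 := ValueDistribution.proximity_mul_top_le
      (f₁ := fun w : ℂ => -w ^ 2) (fun w => by fun_prop) (hG.logDeriv.mul (hG.div hF)) R
    have h2 := ValueDistribution.proximity_mul_top_le hG.logDeriv (hG.div hF) R
    rw [Pi.add_apply] at h1 h2
    rw [proximity_neg_sq hR] at h1
    have h3 := hm R hR
    have h4 := h R hR
    have hpow : (1 : ℝ) ≤ 6 ^ j := one_le_pow₀ (by norm_num)
    have hpR : 1 ≤ 6 ^ j * R := one_le_mul_of_one_le_of_one_le hpow hR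
    have h5 : ValueDistribution.characteristic F ⊤ (6 ^ j * R)
        ≤ ValueDistribution.characteristic F ⊤ (6 ^ (j + 1) * R) := by
      refine ValueDistribution.characteristic_monotoneOn hF (Set.mem_Ioi.2 (by linarith))
        (Set.mem_Ioi.2 (by rw [pow_succ]; linarith)) ?_
      rw [pow_succ]
      linarith
    have h6 := hT (6 * R) (by linarith)
    rw [← mul_assoc, ← pow_succ] at h6
    have h7 : 0 ≤ ValueDistribution.characteristic F ⊤ (6 ^ j * R) :=
      ValueDistribution.characteristic_nonneg hpR
    set T := ValueDistribution.characteristic F ⊤ (6 ^ (j + 1) * R)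
    have h8 := posLog_le_posLog h7 h5
    have h9 : log⁺ (ValueDistribution.characteristic (invDeriv^[j] F) ⊤ (6 * R))
        ≤ log C₂ + 2 * log 2 + log 6 + log R + log⁺ T := by
      refine (posLog_le_posLog (ValueDistribution.characteristic_nonneg (by linarith)) h6).trans ?_
      refine posLog_mul.trans ?_
      rw [posLog_eq_log (by rwa [abs_of_nonneg (by linarith)])]
      have a1 := posLog_add (x := 1 + log (6 * R)) (y := T)
      have a2 := posLog_add (x := 1) (y := log (6 * R))
      have a3 : log⁺ (log (6 * R)) ≤ log (6 * R) := by
        have : 0 ≤ log (6 * R) := log_nonneg (by linarith)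
        rw [posLog_apply]
        exact max_le this (log_le_self this)
      rw [log_mul (by norm_num) (by linarith)] at *
      rw [posLog_one] at a2
      linarith
    have h10 := posLog_nonneg (x := T)
    have h11 : C * (1 + log R + log⁺ (ValueDistribution.characteristic F ⊤ (6 ^ j * R)))
      ≤ C * (1 + log R + log⁺ T) := by gcongr
    set E := log C₂ + 2 * log 2 + log 6 with hE
    have hE0 : 0 ≤ E := by positivity
    nlinarith [mul_nonneg hC₁ hR1, mul_nonneg hC₁ h10, mul_nonneg hE0 hR1, mul_nonneg hE0 h10]

end NevanlinnaNear

namespace NevanlinnaNear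

open Real Metric MeromorphicOn MeasureTheory

/-! ### The coordinate `w = 1 / (z - z₀)` -/

/-- The function `f` in the coordinate `w = 1 / (z - z₀)`. -/
noncomputable def inInvCoord (f : ℂ → ℂ) (z₀ : ℂ) : ℂ → ℂ := fun w => f (z₀ + w⁻¹)

theorem hasDerivAt_const_add_inv (z₀ : ℂ) {w : ℂ} (hw : w ≠ 0) :
    HasDerivAt (fun w : ℂ => z₀ + w⁻¹) (-(w ^ 2)⁻¹) w :=
  (hasDerivAt_inv hw).const_add z₀

theorem analyticAt_const_add_inv (z₀ : ℂ) {w : ℂ} (hw : w ≠ 0) :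
    AnalyticAt ℂ (fun w : ℂ => z₀ + w⁻¹) w := by
  fun_prop (disch := assumption)

/-- Infinity is defined through `1 / z` rather than `1 / (z - z₀)`. The two coordinates differ by a
map with derivative `1` at the origin, so orders and multiplicities agree. -/
theorem inInvCoord_eventuallyEq_comp (f : ℂ → ℂ) (z₀ : ℂ) :
    inInvCoord f z₀ =ᶠ[𝓝[≠] 0] (fun v : ℂ => f v⁻¹) ∘ fun w => w / (1 + z₀ * w) := by
  filter_upwards [self_mem_nhdsWithin] with w hw
  have hw' : w ≠ 0 := hw
  simp only [inInvCoord, Function.comp_apply, inv_div, add_div]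
  congr 1
  field_simp
  ring

theorem analyticAt_div_one_add (z₀ : ℂ) : AnalyticAt ℂ (fun w : ℂ => w / (1 + z₀ * w)) 0 := by
  have : (1 + z₀ * 0 : ℂ) ≠ 0 := by simp
  fun_prop (disch := assumption)

theorem deriv_div_one_add (z₀ : ℂ) : deriv (fun w : ℂ => w / (1 + z₀ * w)) 0 = 1 := by
  have h : HasDerivAt (fun w : ℂ => w / (1 + z₀ * w)) _ 0 :=
    (hasDerivAt_id (0 : ℂ)).div (((hasDerivAt_id (0 : ℂ)).const_mul z₀).const_add 1) (by simp)
  rw [h.deriv]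
  simp

theorem meromorphicOrderAt_inInvCoord (f : ℂ → ℂ) (z₀ : ℂ) {w : ℂ} (hw : w ≠ 0) :
    meromorphicOrderAt (inInvCoord f z₀) w = meromorphicOrderAt f (z₀ + w⁻¹) := by
  refine meromorphicOrderAt_comp_of_deriv_ne_zero (f := f) (analyticAt_const_add_inv z₀ hw) ?_
  rw [(hasDerivAt_const_add_inv z₀ hw).deriv]
  simpa using hw

theorem meromorphicOrderAt_inInvCoord_zero (f : ℂ → ℂ) (z₀ : ℂ) :
    meromorphicOrderAt (inInvCoord f z₀) 0 = meromorphicOrderAt (fun w : ℂ => f w⁻¹) 0 := by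
  rw [meromorphicOrderAt_congr (inInvCoord_eventuallyEq_comp f z₀),
    meromorphicOrderAt_comp_of_deriv_ne_zero (analyticAt_div_one_add z₀)
      (by rw [deriv_div_one_add]; simp)]
  simp

theorem meromorphic_inInvCoord {f : ℂ → ℂ} {z₀ : ℂ} (hf : MeromorphicOffPoint f z₀) :
    Meromorphic (inInvCoord f z₀) := by
  intro w
  rcases eq_or_ne w 0 with rfl | hw
  · refine MeromorphicAt.congr ?_ (inInvCoord_eventuallyEq_comp f z₀).symm
    refine MeromorphicAt.comp_analyticAt ?_ (analyticAt_div_one_add z₀)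
    simpa using hf.2
  · refine MeromorphicAt.comp_analyticAt (hf.1 _ ?_) (analyticAt_const_add_inv z₀ hw)
    simpa using hw

theorem poleMult_inInvCoord (f : ℂ → ℂ) (z₀ : ℂ) {w : ℂ} (hw : w ≠ 0) :
    poleMult (inInvCoord f z₀) w = poleMult f (z₀ + w⁻¹) := by
  rw [poleMult, poleMult, meromorphicOrderAt_inInvCoord f z₀ hw]

theorem poleMult_inInvCoord_zero (f : ℂ → ℂ) (z₀ : ℂ) :
    poleMult (inInvCoord f z₀) 0 = poleMultInfty f := by
  rw [poleMultInfty, poleMult, poleMult, meromorphicOrderAt_inInvCoord_zero]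

theorem negPart_divisor_eq_poleMult {F : ℂ → ℂ} (hF : Meromorphic F) (w : ℂ) :
    (divisor F Set.univ)⁻ w = poleMult F w := by
  rw [Function.locallyFinsuppWithin.negPart_apply, divisor_apply hF.meromorphicOn (Set.mem_univ w),
    poleMult, Int.toNat_eq_max]
  rfl

/-- Inversion reverses the orientation of the circle, and the mean over the unit circle is invariant
under `ζ ↦ ζ⁻¹`. -/
theorem proximity_eq (f : ℂ → ℂ) (z₀ : ℂ) (r : ℝ) :
    proximity f z₀ r = ValueDistribution.proximity (inInvCoord f z₀) ⊤ r⁻¹ := by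
  rw [proximity, ValueDistribution.proximity_top, circleAverage_eq_circleAverage_zero_one,
    ← circleAverage_zero_one_congr_inv, circleAverage_eq_circleAverage_zero_one (R := r⁻¹)]
  congr 1
  ext z
  simp [inInvCoord, add_comm, mul_comm]

theorem integral_Ioi_ite_div {r a m : ℝ} (hr : 0 < r) (hra : r ≤ a) :
    IntegrableOn (fun t : ℝ => (if t ≤ a then m else 0) / t) (Set.Ioi r) ∧
      ∫ t in Set.Ioi r, (if t ≤ a then m else 0) / t = m * (log a - log r) := by
  have h1 : (fun t : ℝ => (if t ≤ a then m else 0) / t)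
      = (Set.Iic a).indicator fun t => m * (1 / t) := by
    ext t
    by_cases h : t ≤ a <;> simp [h, div_eq_mul_inv]
  have h2 : Set.Ioi r ∩ Set.Iic a = Set.Ioc r a := rfl
  rw [h1]
  constructor
  · rw [IntegrableOn, integrable_indicator_iff measurableSet_Iic, IntegrableOn,
      Measure.restrict_restrict measurableSet_Iic, Set.inter_comm, h2]
    have : IntervalIntegrable (fun t : ℝ => m * (1 / t)) volume r a := by
      refine ContinuousOn.intervalIntegrable fun t ht => ?_
      rw [Set.uIcc_of_le hra] at ht
      have : t ≠ 0 := by linarith [ht.1]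
      fun_prop (disch := assumption)
    exact (intervalIntegrable_iff_integrableOn_Ioc_of_le hra).1 this
  · rw [setIntegral_indicator measurableSet_Iic, h2, ← intervalIntegral.integral_of_le hra,
      intervalIntegral.integral_const_mul, integral_one_div_of_pos hr (by linarith),
      log_div (by linarith) hr.ne']

/-- A pole `z₀ + u⁻¹` of multiplicity `n` contributes `n` times the integral of `1 / t` from `r` to
`‖u‖⁻¹`, which is its term in the classical counting function. The pole at infinity is `u = 0` and
accounts for the term with `log r`. -/
theorem counting_eq {f : ℂ → ℂ} {z₀ : ℂ} (hf : MeromorphicOffPoint f z₀) {r : ℝ} (hr : 0 < r) :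
    counting f z₀ r = ValueDistribution.logCounting (inInvCoord f z₀) ⊤ r⁻¹ := by
  have hF := meromorphic_inInvCoord hf
  set F := inInvCoord f z₀ with hFdef
  rw [ValueDistribution.logCounting_top, logCounting_eq_finsum _ (inv_ne_zero hr.ne')]
  set E := (divisor F Set.univ)⁻ with hE
  have hfin : (Function.support ⇑(E.toClosedBall r⁻¹)).Finite :=
    (E.toClosedBall r⁻¹).finiteSupport (isCompact_closedBall _ _)
  set S : Finset ℂ := insert 0 hfin.toFinset with hS
  have hball : ∀ u, u ∈ closedBall (0 : ℂ) |r⁻¹| ↔ ‖u‖ ≤ r⁻¹ := fun u => by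
    rw [mem_closedBall_zero_iff, abs_of_pos (inv_pos.2 hr)]
  have hEv : ∀ u, ‖u‖ ≤ r⁻¹ → E.toClosedBall r⁻¹ u = poleMult F u := fun u hu => by
    rw [Function.locallyFinsuppWithin.toClosedBall_eval_within _ ((hball u).2 hu), hE,
      negPart_divisor_eq_poleMult hF]
  have hSle : ∀ u ∈ S, ‖u‖ ≤ r⁻¹ := by
    intro u hu
    rcases Finset.mem_insert.1 hu with rfl | hu
    · simpa using hr.le
    · rw [← hball]
      exact (E.toClosedBall r⁻¹).supportWithinDomain (by simpa using hu)
  have h0S : (0 : ℂ) ∈ S := Finset.mem_insert_self _ _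
  have hrhs : ∑ᶠ u, (E.toClosedBall r⁻¹ u : ℝ) * (log r⁻¹ - log ‖u‖)
      = ∑ u ∈ S.erase 0, (poleMult F u : ℝ) * (log ‖u‖⁻¹ - log r)
        - (poleMultInfty f : ℝ) * log r := by
    rw [finsum_eq_sum_of_support_subset (s := S), ← Finset.sum_erase_add _ _ h0S, hEv 0 (by
      simpa using hr.le), hFdef, poleMult_inInvCoord_zero, ← hFdef]
    · simp only [norm_zero, log_zero, log_inv, sub_zero, mul_neg, Int.cast_natCast]
      rw [← sub_eq_add_neg]
      congr 1
      refine Finset.sum_congr rfl fun u hu => ?_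
      rw [hEv u (hSle u (Finset.mem_of_mem_erase hu))]
      push_cast
      ring
    · intro u hu
      refine Finset.mem_insert_of_mem ?_
      simp only [Set.Finite.mem_toFinset, Function.mem_support]
      intro h0
      exact hu (by simp [h0])
  rw [hrhs, counting]
  congr 1
  -- the number of poles as a finite sum
  have hcount : ∀ t, r < t → (countPoles f z₀ t : ℝ) - (poleMultInfty f : ℝ)
      = ∑ u ∈ S.erase 0, if t ≤ ‖u‖⁻¹ then (poleMult F u : ℝ) else 0 := by
    intro t ht
    have hfs : (∑ᶠ (z : ℂ) (_ : t ≤ ‖z - z₀‖), poleMult f z)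
        = ∑ u ∈ S.erase 0, if t ≤ ‖u‖⁻¹ then poleMult F u else 0 := by
      -- With `0⁻¹ = 0` the map `u ↦ z₀ + u⁻¹` is a bijection of the plane. It sends `0` to `z₀`,
      -- which the condition `t ≤ ‖z - z₀‖` excludes since `t > 0`.
      rw [← finsum_comp_equiv ((Equiv.inv ℂ).trans (Equiv.addLeft z₀))]
      have hterm : ∀ u : ℂ, (∑ᶠ (_ : t ≤ ‖((Equiv.inv ℂ).trans (Equiv.addLeft z₀)) u - z₀‖),
          poleMult f (((Equiv.inv ℂ).trans (Equiv.addLeft z₀)) u))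
          = if t ≤ ‖u‖⁻¹ then poleMult F u else 0 := by
        intro u
        have h1 : ((Equiv.inv ℂ).trans (Equiv.addLeft z₀)) u = z₀ + u⁻¹ := rfl
        rw [h1, add_sub_cancel_left, norm_inv]
        by_cases h : t ≤ ‖u‖⁻¹
        · have hu : u ≠ 0 := by
            rintro rfl
            simp only [norm_zero, inv_zero] at h
            linarith
          simp only [h, finsum_true, if_true]
          rw [hFdef, poleMult_inInvCoord f z₀ hu]
        · simp [h]
      simp only [hterm]
      refine finsum_eq_sum_of_support_subset _ ?_
      intro u hu
      rw [Function.mem_support] at hu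
      have hle : t ≤ ‖u‖⁻¹ := by
        by_contra h
        exact hu (if_neg h)
      rw [if_pos hle] at hu
      have hu0 : u ≠ 0 := by
        rintro rfl
        simp only [norm_zero, inv_zero] at hle
        linarith
      have hun : ‖u‖ ≤ r⁻¹ := by
        rw [le_inv_comm₀ (norm_pos_iff.2 hu0) hr]
        linarith
      refine Finset.mem_coe.2 (Finset.mem_erase.2 ⟨hu0, Finset.mem_insert_of_mem ?_⟩)
      simp only [Set.Finite.mem_toFinset, Function.mem_support, hEv u hun]
      exact_mod_cast hu
    rw [countPoles, hfs]
    push_cast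
    ring
  have hle : ∀ u ∈ S.erase 0, r ≤ ‖u‖⁻¹ := fun u hu => by
    rw [le_inv_comm₀ hr (norm_pos_iff.2 (Finset.ne_of_mem_erase hu))]
    exact hSle u (Finset.mem_of_mem_erase hu)
  rw [setIntegral_congr_fun (g := fun t => ∑ u ∈ S.erase 0,
    (if t ≤ ‖u‖⁻¹ then (poleMult F u : ℝ) else 0) / t) measurableSet_Ioi
    fun t ht => by simp only [hcount t ht, Finset.sum_div]]
  rw [integral_finsetSum _ fun u hu => (integral_Ioi_ite_div hr (hle u hu)).1]
  exact Finset.sum_congr rfl fun u hu => (integral_Ioi_ite_div hr (hle u hu)).2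

theorem characteristic_eq {f : ℂ → ℂ} {z₀ : ℂ} (hf : MeromorphicOffPoint f z₀) {r : ℝ}
    (hr : 0 < r) :
    characteristic f z₀ r = ValueDistribution.characteristic (inInvCoord f z₀) ⊤ r⁻¹ := by
  rw [characteristic, proximity_eq, counting_eq hf hr]
  rfl

theorem iteratedDeriv_eq_invDeriv_iterate (f : ℂ → ℂ) (z₀ : ℂ) (j : ℕ) {w : ℂ} (hw : w ≠ 0) :
    iteratedDeriv j f (z₀ + w⁻¹) = invDeriv^[j] (inInvCoord f z₀) w := by
  induction j generalizing w with
  | zero => rfl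
  | succ j ih =>
    rw [iteratedDeriv_succ, Function.iterate_succ_apply', invDeriv]
    have heq : invDeriv^[j] (inInvCoord f z₀) =ᶠ[𝓝 w]
        fun v => iteratedDeriv j f (z₀ + v⁻¹) := by
      filter_upwards [isOpen_ne.mem_nhds hw] with v hv
      exact (ih hv).symm
    rw [heq.deriv_eq]
    generalize iteratedDeriv j f = g
    by_cases hd : DifferentiableAt ℂ g (z₀ + w⁻¹)
    · have h := hd.hasDerivAt.comp w (hasDerivAt_const_add_inv z₀ hw)
      have h' : deriv (fun v => g (z₀ + v⁻¹)) w = _ := h.deriv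
      rw [h']
      field_simp
    -- Differentiability passes back through the inverse map `z ↦ (z - z₀)⁻¹`, so both derivatives
    -- take the default value `0` together and the identity holds even at poles.
    · have hnd : ¬ DifferentiableAt ℂ (fun v => g (z₀ + v⁻¹)) w := by
        intro hc
        apply hd
        have hc' : DifferentiableAt ℂ (fun v => g (z₀ + v⁻¹)) ((z₀ + w⁻¹ - z₀)⁻¹) := by
          simpa using hc
        have hi : DifferentiableAt ℂ (fun z : ℂ => (z - z₀)⁻¹) (z₀ + w⁻¹) := by
          refine DifferentiableAt.inv (by fun_prop) ?_
          simpa using hw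
        have := hc'.comp (z₀ + w⁻¹) hi
        simpa [Function.comp_def] using this
      rw [deriv_zero_of_not_differentiableAt hd, deriv_zero_of_not_differentiableAt hnd, mul_zero]

/-- Codiscrete sets off `z₀` are, in the coordinate `w = 1 / (z - z₀)`, punctured neighbourhoods
at all points other than the origin. -/
theorem eventually_inInvCoord {z₀ : ℂ} {p : ℂ → Prop}
    (h : ∀ᶠ z in codiscreteWithin ({z₀}ᶜ : Set ℂ), p z) {w : ℂ} (hw : w ≠ 0) :
    ∀ᶠ v in 𝓝[≠] w, p (z₀ + v⁻¹) := by
  have h1 := mem_codiscreteWithin_iff_forall_mem_nhdsNE.1 h (z₀ + w⁻¹) (by simpa using hw)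
  have h2 : Tendsto (fun v : ℂ => z₀ + v⁻¹) (𝓝[≠] w) (𝓝[≠] (z₀ + w⁻¹)) := by
    refine tendsto_nhdsWithin_of_tendsto_nhds_of_eventually_within _
      ((analyticAt_const_add_inv z₀ hw).continuousAt.tendsto.mono_left nhdsWithin_le_nhds) ?_
    filter_upwards [self_mem_nhdsWithin] with v hv
    simpa using hv
  filter_upwards [h2 h1, nhdsWithin_le_nhds (isOpen_ne.mem_nhds hw)] with v hv hv0
  rcases hv with hv | hv
  · exact hv
  · simp at hv
    exact absurd hv hv0

/-- By the identity theorem one punctured neighbourhood suffices; `1` is a point away from the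
origin, where the coordinate degenerates. -/
theorem eventuallyEq_zero_of_forall_ne {E : ℂ → ℂ} (hE : Meromorphic E)
    (h : ∀ᶠ v in 𝓝[≠] (1 : ℂ), E v = 0) : E =ᶠ[codiscrete ℂ] 0 :=
  eventuallyEq_zero_of_order_eq_top hE (meromorphicOrderAt_eq_top_iff.2 h)

theorem IsSolution.invDeriv_add_sum_eventuallyEq_zero {k : ℕ} {A : ℕ → ℂ → ℂ} {z₀ : ℂ} {f : ℂ → ℂ}
    (hA : ∀ j < k, MeromorphicOffPoint (A j) z₀) (hf : MeromorphicOffPoint f z₀)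
    (h : IsSolution k A z₀ f) :
    invDeriv^[k] (inInvCoord f z₀) + ∑ j ∈ Finset.range k,
      inInvCoord (A j) z₀ * invDeriv^[j] (inInvCoord f z₀)
      =ᶠ[codiscrete ℂ] 0 := by
  have hF := meromorphic_inInvCoord hf
  refine eventuallyEq_zero_of_forall_ne ?_ ?_
  · refine (meromorphic_invDeriv_iterate hF k).add (Meromorphic.sum fun j hj => ?_)
    exact (meromorphic_inInvCoord (hA j (Finset.mem_range.1 hj))).mul
      (meromorphic_invDeriv_iterate hF j)
  · filter_upwards [eventually_inInvCoord h one_ne_zero,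
      nhdsWithin_le_nhds (isOpen_ne.mem_nhds (one_ne_zero (α := ℂ)))] with v hv hv0
    have hv0' : v ≠ 0 := hv0
    simp only [iteratedDeriv_eq_invDeriv_iterate f z₀ _ hv0'] at hv
    simpa [Finset.sum_apply, inInvCoord] using hv

theorem meromorphicOrderAt_inInvCoord_ne_top {z₀ : ℂ} {f : ℂ → ℂ} (hf : MeromorphicOffPoint f z₀)
    (hf_ne : ¬ f =ᶠ[codiscreteWithin ({z₀}ᶜ : Set ℂ)] 0) (w : ℂ) :
    meromorphicOrderAt (inInvCoord f z₀) w ≠ ⊤ := by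
  intro htop
  apply hf_ne
  have hall := eventually_codiscrete_iff.1
    (eventuallyEq_zero_of_order_eq_top (meromorphic_inInvCoord hf) htop)
  rw [Filter.EventuallyEq, Filter.Eventually, mem_codiscreteWithin_iff_forall_mem_nhdsNE]
  intro z hz
  have hz0 : z - z₀ ≠ 0 := sub_ne_zero.2 hz
  have := meromorphicOrderAt_eq_top_iff.2 (hall (z - z₀)⁻¹)
  rw [meromorphicOrderAt_inInvCoord f z₀ (inv_ne_zero hz0), inv_inv, add_sub_cancel,
    meromorphicOrderAt_eq_top_iff] at this
  filter_upwards [this] with v hv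
  exact Or.inl hv

end NevanlinnaNear

namespace NevanlinnaNear

open Real Metric MeromorphicOn

/-! ### Constant and nonconstant coefficients -/

theorem log_le_logCounting_of_order_neg {F : ℂ → ℂ} (hF : Meromorphic F)
    (h : meromorphicOrderAt F 0 < 0) {R : ℝ} (hR : 1 ≤ R) :
    log R ≤ ValueDistribution.logCounting F ⊤ R := by
  classical
  have hle : Function.locallyFinsuppWithin.single (0 : ℂ) (1 : ℤ) ≤ (divisor F Set.univ)⁻ := by
    intro z
    rw [Function.locallyFinsuppWithin.negPart_apply, divisor_apply hF.meromorphicOn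
      (Set.mem_univ z)]
    rcases eq_or_ne z 0 with rfl | hz
    · have h1 : (meromorphicOrderAt F 0).untop₀ < 0 := by
        lift meromorphicOrderAt F 0 to ℤ using h.ne_top with n
        simpa using h
      have h2 : (meromorphicOrderAt F 0).untop₀⁻ = -(meromorphicOrderAt F 0).untop₀ :=
        negPart_eq_neg.2 h1.le
      rw [h2]
      simp
      omega
    · simp [hz, negPart_nonneg]
  have := Function.locallyFinsuppWithin.logCounting_le hle hR
  rw [Function.locallyFinsuppWithin.logCounting_single_eq_log_sub_const
    (by simpa using (by linarith : 0 ≤ R))] at this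
  rw [ValueDistribution.logCounting_top]
  simpa using this

/-- The characteristic of a nonconstant meromorphic function grows at least like `log R`. -/
theorem eventuallyEq_const_or_log_le_characteristic {F : ℂ → ℂ} (hF : Meromorphic F) :
    (∃ a : ℂ, F =ᶠ[codiscrete ℂ] fun _ => a) ∨
      ∃ C, ∀ R, 1 ≤ R → log R - C ≤ ValueDistribution.characteristic F ⊤ R := by
  rcases lt_or_ge (meromorphicOrderAt F 0) 0 with h | h
  · refine Or.inr ⟨0, fun R hR => ?_⟩
    rw [sub_zero]
    exact (log_le_logCounting_of_order_neg hF h hR).trans (logCounting_le_characteristic F R)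
  -- If `F` is finite at the origin with limit `a`, then `(F - a)⁻¹` has a pole there unless `F` is
  -- constant. The characteristic changes by a bounded amount under shift and inversion.
  · obtain ⟨a, ha⟩ := tendsto_nhds_of_meromorphicOrderAt_nonneg (hF 0) h
    have hG : Meromorphic fun z => F z - a := hF.sub (fun z => MeromorphicAt.const a z)
    have hpos : 0 < meromorphicOrderAt (fun z => F z - a) 0 := by
      rw [← tendsto_zero_iff_meromorphicOrderAt_pos (hG 0)]
      simpa using ha.sub_const a
    by_cases htop : meromorphicOrderAt (fun z => F z - a) 0 = ⊤
    · refine Or.inl ⟨a, ?_⟩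
      filter_upwards [eventuallyEq_zero_of_order_eq_top hG htop] with z hz
      exact sub_eq_zero.1 hz
    · obtain ⟨C, -, hC⟩ := characteristic_inv_le hG
      refine Or.inr ⟨C + (log⁺ ‖a‖ + log 2), fun R hR => ?_⟩
      have hneg : meromorphicOrderAt (fun z => F z - a)⁻¹ 0 < 0 := by
        rw [meromorphicOrderAt_inv]
        lift meromorphicOrderAt (fun z => F z - a) 0 to ℤ using htop with n
        norm_cast at hpos ⊢
        omega
      have h1 := (log_le_logCounting_of_order_neg hG.inv hneg hR).trans
        (logCounting_le_characteristic _ R)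
      have h2 := hC R hR
      have h3 := ValueDistribution.abs_characteristic_sub_characteristic_shift_le
        (a₀ := a) (r := R) hF
      have h4 := neg_abs_le (ValueDistribution.characteristic F ⊤ R
        - ValueDistribution.characteristic (fun z => F z - a) ⊤ R)
      linarith

/-- The double zero of `w²` beats the pole of the logarithmic derivative, which is at most simple.
-/
theorem tendsto_neg_sq_mul_logDeriv {G : ℂ → ℂ} (hG : Meromorphic G) :
    Tendsto ((fun w : ℂ => -w ^ 2) * logDeriv G) (𝓝[≠] 0) (𝓝 0) := by
  have hsq : meromorphicOrderAt (fun w : ℂ => -w ^ 2) 0 = (2 : ℤ) := by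
    rw [← meromorphicOrderAt_fun_neg]
    have := fun_meromorphicOrderAt_pow_id_sub_const (𝕜 := ℂ) (x := 0) (n := 2)
    simpa using this
  have hld : ((-1 : ℤ) : WithTop ℤ) ≤ meromorphicOrderAt (logDeriv G) 0 := by
    by_cases h0 : meromorphicOrderAt G 0 = 0
    · exact le_trans (by norm_cast) (meromorphicOrderAt_logDeriv_nonneg (hG 0) h0)
    · by_cases htop : meromorphicOrderAt G 0 = ⊤
      · have h1 : logDeriv G =ᶠ[𝓝[≠] 0] logDeriv 0 :=
          logDeriv_congr_nhdsNE (meromorphicOrderAt_eq_top_iff.1 htop)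
        rw [show (0 : ℂ → ℂ) = fun _ => 0 from rfl, logDeriv_const] at h1
        rw [meromorphicOrderAt_eq_top_iff.2 h1]
        exact le_top
      · rw [meromorphicOrderAt_logDeriv_eq_neg_one (hG 0) h0 htop]
        norm_cast
  refine tendsto_zero_of_meromorphicOrderAt_pos ?_
  rw [meromorphicOrderAt_mul (by fun_prop) (hG 0).logDeriv, hsq]
  refine lt_of_lt_of_le ?_ (add_le_add_right hld _)
  norm_cast

theorem tendsto_invDeriv_iterate_succ_div {F : ℂ → ℂ} (hF : Meromorphic F)
    (hne : meromorphicOrderAt F 0 ≠ ⊤) (j : ℕ) :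
    Tendsto (invDeriv^[j + 1] F / F) (𝓝[≠] 0) (𝓝 0) := by
  -- Only a finite limit is propagated, since for `j = 0` the limit is `1`; one more factor `-w²`
  -- times a logarithmic derivative makes it `0`.
  have hbd : ∃ c, Tendsto (invDeriv^[j] F / F) (𝓝[≠] 0) (𝓝 c) := by
    induction j with
    | zero =>
      refine ⟨1, tendsto_const_nhds.congr' ?_⟩
      filter_upwards [(meromorphicOrderAt_ne_top_iff_eventually_ne_zero (hF 0)).1 hne] with w hw
      simp [div_self hw]
    | succ j ih =>
      obtain ⟨c, hc⟩ := ih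
      refine ⟨0, ?_⟩
      have := (tendsto_neg_sq_mul_logDeriv (meromorphic_invDeriv_iterate hF j)).mul hc
      rw [zero_mul] at this
      refine this.congr' ?_
      filter_upwards [eventually_codiscrete_iff.1
        (invDeriv_eventuallyEq (meromorphic_invDeriv_iterate hF j)) 0] with w hw
      simp only [Function.iterate_succ_apply', Pi.div_apply, Pi.mul_apply] at hw ⊢
      rw [hw]
      ring
  obtain ⟨c, hc⟩ := hbd
  have := (tendsto_neg_sq_mul_logDeriv (meromorphic_invDeriv_iterate hF j)).mul hc
  rw [zero_mul] at this
  refine this.congr' ?_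
  filter_upwards [eventually_codiscrete_iff.1
    (invDeriv_eventuallyEq (meromorphic_invDeriv_iterate hF j)) 0] with w hw
  simp only [Function.iterate_succ_apply', Pi.div_apply, Pi.mul_apply] at hw ⊢
  rw [hw]
  ring

theorem neg_coeff_zero_eventuallyEq {m : ℕ} {F : ℂ → ℂ} {B : ℕ → ℂ → ℂ} (hF : Meromorphic F)
    (hne : ∀ z, meromorphicOrderAt F z ≠ ⊤)
    (h : invDeriv^[m + 1] F + ∑ j ∈ Finset.range (m + 1), B j * invDeriv^[j] F
      =ᶠ[codiscrete ℂ] 0) :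
    -B 0 =ᶠ[codiscrete ℂ] invDeriv^[m + 1] F / F
      + ∑ j ∈ Finset.range m, B (j + 1) * (invDeriv^[j + 1] F / F) := by
  filter_upwards [h, (hF.meromorphicOn (s := Set.univ)).eventually_codiscreteWithin_apply_ne_zero
      fun z _ => hne z] with w hw hw0
  rw [Pi.add_apply, Finset.sum_range_succ'] at hw
  simp only [Pi.add_apply, Finset.sum_apply, Pi.mul_apply, Pi.zero_apply, Function.iterate_zero,
    id_eq, Pi.neg_apply, Pi.div_apply] at hw ⊢
  have h1 : ∑ j ∈ Finset.range m, B (j + 1) w * (invDeriv^[j + 1] F w / F w)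
      = (∑ j ∈ Finset.range m, B (j + 1) w * invDeriv^[j + 1] F w) / F w := by
    rw [Finset.sum_div]
    exact Finset.sum_congr rfl fun j _ => (mul_div_assoc _ _ _).symm
  rw [h1, ← add_div, eq_div_iff hw0]
  linear_combination -hw

/-- An equation with constant coefficients, the last of which is not zero, has no solution that is
meromorphic at infinity. -/
theorem coeff_zero_eq_zero_of_const {m : ℕ} {F : ℂ → ℂ} {B : ℕ → ℂ → ℂ} (hF : Meromorphic F)
    (hne : ∀ z, meromorphicOrderAt F z ≠ ⊤)
    (h : invDeriv^[m + 1] F + ∑ j ∈ Finset.range (m + 1), B j * invDeriv^[j] F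
      =ᶠ[codiscrete ℂ] 0) {c : ℕ → ℂ}
    (hc : ∀ j < m + 1, B j =ᶠ[codiscrete ℂ] fun _ => c j) : c 0 = 0 := by
  have h1 := eventually_codiscrete_iff.1 (neg_coeff_zero_eventuallyEq hF hne h) 0
  have hB : ∀ j < m + 1, Tendsto (B j) (𝓝[≠] 0) (𝓝 (c j)) := fun j hj =>
    tendsto_const_nhds.congr' (EventuallyEq.symm (eventually_codiscrete_iff.1 (hc j hj) 0))
  have h2 : Tendsto (invDeriv^[m + 1] F / F
      + ∑ j ∈ Finset.range m, B (j + 1) * (invDeriv^[j + 1] F / F)) (𝓝[≠] 0) (𝓝 0) := by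
    have hs : Tendsto (∑ j ∈ Finset.range m, B (j + 1) * (invDeriv^[j + 1] F / F)) (𝓝[≠] 0)
        (𝓝 (∑ j ∈ Finset.range m, c (j + 1) * 0)) := by
      have := tendsto_finsetSum (x := 𝓝[≠] (0 : ℂ)) (Finset.range m)
        (f := fun j => B (j + 1) * (invDeriv^[j + 1] F / F)) (a := fun j => c (j + 1) * 0)
        fun j hj => (hB (j + 1) (by have := Finset.mem_range.1 hj; omega)).mul
          (tendsto_invDeriv_iterate_succ_div hF (hne 0) j)
      simpa [Finset.sum_fn] using this
    have := (tendsto_invDeriv_iterate_succ_div hF (hne 0) m).add hs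
    simp only [mul_zero, Finset.sum_const_zero, add_zero] at this
    exact this
  have h3 : Tendsto (-B 0) (𝓝[≠] 0) (𝓝 (-c 0)) := (hB 0 (by omega)).neg
  have := tendsto_nhds_unique h3 (h2.congr' (EventuallyEq.symm h1))
  simpa using this

/-! ### The proximity function of the last coefficient -/

theorem proximity_neg (F : ℂ → ℂ) :
    ValueDistribution.proximity (-F) ⊤ = ValueDistribution.proximity F ⊤ := by
  rw [ValueDistribution.proximity_top, ValueDistribution.proximity_top]
  simp

theorem exists_proximity_coeff_zero_le {m : ℕ} {F : ℂ → ℂ} {B : ℕ → ℂ → ℂ} (hF : Meromorphic F)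
    (hB : ∀ j < m + 1, Meromorphic (B j)) (hne : ∀ z, meromorphicOrderAt F z ≠ ⊤)
    (h : invDeriv^[m + 1] F + ∑ j ∈ Finset.range (m + 1), B j * invDeriv^[j] F
      =ᶠ[codiscrete ℂ] 0) :
    ∃ C, 0 < C ∧ ∀ R, 1 ≤ R → ValueDistribution.proximity (B 0) ⊤ R
      ≤ C * (1 + log R + log⁺ (ValueDistribution.characteristic F ⊤ (6 ^ (m + 1) * R)))
        + ∑ j ∈ Finset.range m, ValueDistribution.characteristic (B (j + 1)) ⊤ R := by
  choose C hC0 hC using fun j => exists_proximity_invDeriv_iterate_div_le hF j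
  have hlm : 0 ≤ log (m : ℝ) := log_natCast_nonneg m
  have hl2 : 0 < log 2 := log_pos (by norm_num)
  have hCs : 0 ≤ ∑ j ∈ Finset.range m, C (j + 1) := Finset.sum_nonneg fun j _ => hC0 _
  have hdiv : ∀ j, Meromorphic (invDeriv^[j] F / F) := fun j =>
    (meromorphic_invDeriv_iterate hF j).div hF
  -- `log m` and `log 2` are the costs of `log⁺` for a sum of `m` terms and of two; they are
  -- absorbed because `X ≥ 1`.
  refine ⟨C (m + 1) + ∑ j ∈ Finset.range m, C (j + 1) + log m + log 2,
    by have := hC0 (m + 1); linarith, fun R hR => ?_⟩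
  have hmono : ∀ j ≤ m + 1, log⁺ (ValueDistribution.characteristic F ⊤ (6 ^ j * R))
      ≤ log⁺ (ValueDistribution.characteristic F ⊤ (6 ^ (m + 1) * R)) := by
    intro j hj
    have h1 : (1 : ℝ) ≤ 6 ^ j := one_le_pow₀ (by norm_num)
    have h2 : (6 : ℝ) ^ j ≤ 6 ^ (m + 1) := pow_le_pow_right₀ (by norm_num) hj
    have h3 : 1 ≤ 6 ^ j * R := one_le_mul_of_one_le_of_one_le h1 hR
    have h4 : 6 ^ j * R ≤ 6 ^ (m + 1) * R := by gcongr
    exact posLog_le_posLog (ValueDistribution.characteristic_nonneg h3)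
      (ValueDistribution.characteristic_monotoneOn hF (Set.mem_Ioi.2 (by linarith))
        (Set.mem_Ioi.2 (by linarith)) h4)
  set X := 1 + log R + log⁺ (ValueDistribution.characteristic F ⊤ (6 ^ (m + 1) * R)) with hX
  have hR0 := log_nonneg hR
  have hX1 : 1 ≤ X := by
    have := posLog_nonneg (x := ValueDistribution.characteristic F ⊤ (6 ^ (m + 1) * R))
    linarith
  have hq : ∀ j ≤ m + 1, ValueDistribution.proximity (invDeriv^[j] F / F) ⊤ R ≤ C j * X := by
    intro j hj
    refine (hC j R hR).trans (mul_le_mul_of_nonneg_left ?_ (hC0 j))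
    have := hmono j hj
    linarith
  rw [← proximity_neg, ValueDistribution.proximity_congr_codiscrete
    (neg_coeff_zero_eventuallyEq hF hne h) (by linarith)]
  have hterm : ∀ j ∈ Finset.range m, Meromorphic (B (j + 1) * (invDeriv^[j + 1] F / F)) :=
    fun j hj => (hB (j + 1) (by have := Finset.mem_range.1 hj; omega)).mul (hdiv _)
  have h1 := ValueDistribution.proximity_add_top_le (hdiv (m + 1)) (Meromorphic.sum hterm) R
  have h2 := ValueDistribution.proximity_sum_top_le (Finset.range m)
    (fun j => B (j + 1) * (invDeriv^[j + 1] F / F)) hterm R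
  simp only [Pi.add_apply, Finset.sum_apply, Finset.card_range] at h1 h2
  have h3 : ∑ j ∈ Finset.range m,
      ValueDistribution.proximity (B (j + 1) * (invDeriv^[j + 1] F / F)) ⊤ R
      ≤ ∑ j ∈ Finset.range m, (ValueDistribution.characteristic (B (j + 1)) ⊤ R
        + C (j + 1) * X) := by
    refine Finset.sum_le_sum fun j hj => ?_
    have hj' := Finset.mem_range.1 hj
    have a1 := ValueDistribution.proximity_mul_top_le (hB (j + 1) (by omega)) (hdiv (j + 1)) R
    rw [Pi.add_apply] at a1
    have a2 := proximity_le_characteristic (B (j + 1)) hR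
    have a3 := hq (j + 1) (by omega)
    linarith
  rw [Finset.sum_add_distrib, ← Finset.sum_mul] at h3
  have h4 := hq (m + 1) le_rfl
  nlinarith [mul_le_mul_of_nonneg_left hX1 hlm, mul_le_mul_of_nonneg_left hX1 hl2.le]

end NevanlinnaNear

namespace NevanlinnaNear

open Real

/-! ### Asymptotics in the scale `log (1 / r)` -/

theorem tendsto_log_one_div : Tendsto (fun r : ℝ => log (1 / r)) (𝓝[>] 0) atTop := by
  simp only [one_div]
  exact tendsto_log_atTop.comp tendsto_inv_nhdsGT_zero

theorem eventually_le_one : ∀ᶠ r : ℝ in 𝓝[>] 0, 0 < r ∧ r ≤ 1 := by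
  filter_upwards [Ioo_mem_nhdsGT (one_pos (α := ℝ))] with r hr
  exact ⟨hr.1, hr.2.le⟩

theorem characteristic_nonneg {f : ℂ → ℂ} {z₀ : ℂ} (hf : MeromorphicOffPoint f z₀) {r : ℝ}
    (hr : 0 < r) (hr1 : r ≤ 1) : 0 ≤ characteristic f z₀ r := by
  rw [characteristic_eq hf hr]
  exact ValueDistribution.characteristic_nonneg ((one_le_inv₀ hr).2 hr1)

theorem eventually_add_le_mul_rpow {m c : ℝ} (hm : 1 < m) (hc : 0 < c) (C : ℝ) :
    ∀ᶠ x : ℝ in atTop, C * (1 + x) ≤ c * x ^ m := by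
  have h1 : Tendsto (fun x : ℝ => c * x ^ (m - 1)) atTop atTop :=
    (tendsto_rpow_atTop (by linarith)).const_mul_atTop hc
  filter_upwards [h1.eventually_ge_atTop (2 * |C|), eventually_ge_atTop 1] with x hx hx1
  have h2 : x ^ m = x ^ (m - 1) * x := by
    rw [rpow_sub_one (by linarith)]
    field_simp
  have h3 : C * (1 + x) ≤ |C| * (1 + x) := by
    gcongr
    exact le_abs_self C
  rw [h2]
  nlinarith [abs_nonneg C]

/-- If `c L^m` is dominated by `1 + L + log⁺ T(r / K)`, where `L = log (1 / r)` and `m > 1`, then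
`log⁺ log⁺ T(r)` is asymptotically at least `m log L`. -/
theorem eventually_le_posLog_posLog_div {T : ℝ → ℝ} {m c C K : ℝ} (hm : 1 < m) (hc : 0 < c)
    (hC : 0 < C) (hK : 0 < K)
    (h : ∀ᶠ r : ℝ in 𝓝[>] 0,
      c * log (1 / r) ^ m ≤ C * (1 + log (1 / r) + log⁺ (T (r / K)))) {s : ℝ} (hs : s < m) :
    ∀ᶠ r : ℝ in 𝓝[>] 0, s ≤ log⁺ (log⁺ (T r)) / log (log (1 / r)) := by
  have hscale : Tendsto (fun r : ℝ => K * r) (𝓝[>] 0) (𝓝[>] 0) := by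
    refine tendsto_nhdsWithin_of_tendsto_nhds_of_eventually_within _ ?_ ?_
    · have : Tendsto (fun r : ℝ => K * r) (𝓝 0) (𝓝 (K * 0)) := tendsto_id.const_mul K
      rw [mul_zero] at this
      exact this.mono_left nhdsWithin_le_nhds
    · filter_upwards [self_mem_nhdsWithin] with r hr
      exact mul_pos hK hr
  have hlow : ∀ᶠ r : ℝ in 𝓝[>] 0, c / (2 * C) * log (1 / r) ^ m ≤ log⁺ (T (r / K)) := by
    filter_upwards [h, tendsto_log_one_div.eventually
      (eventually_add_le_mul_rpow hm (half_pos hc) C)] with r h1 h2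
    rw [div_mul_eq_mul_div, div_le_iff₀ (by positivity)]
    linarith
  -- The hypothesis is used at `K * r`, where `log (1 / (K * r)) ≥ log (1 / r) / 2`; hence the
  -- factor `(1 / 2) ^ m`.
  set d : ℝ := c / (2 * C) * (1 / 2) ^ m with hd
  have hd0 : 0 < d := by positivity
  have hloglog := tendsto_log_atTop.comp tendsto_log_one_div
  filter_upwards [hscale.eventually hlow, tendsto_log_one_div.eventually_ge_atTop (2 * |log K|),
    tendsto_log_one_div.eventually_gt_atTop 0, hloglog.eventually_gt_atTop 0,
    hloglog.eventually_ge_atTop (-log d / (m - s)), eventually_le_one] with r h1 h2 h3 h4 h5 h6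
  rw [mul_div_cancel_left₀ _ hK.ne'] at h1
  have h7 : log (1 / r) / 2 ≤ log (1 / (K * r)) := by
    have h7' : log (1 / (K * r)) = -log K + log (1 / r) := by
      rw [one_div, one_div, mul_inv, log_mul (inv_ne_zero hK.ne') (inv_ne_zero h6.1.ne'),
        log_inv K]
    have := le_abs_self (log K)
    linarith
  have h8 : d * log (1 / r) ^ m ≤ log⁺ (T r) := by
    refine le_trans ?_ h1
    rw [hd, mul_assoc, ← mul_rpow (by norm_num) h3.le]
    gcongr
    linarith
  simp only [Function.comp_apply] at h4 h5
  rw [le_div_iff₀ h4]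
  have h9 : log d + m * log (log (1 / r)) ≤ log⁺ (log⁺ (T r)) := by
    rw [← log_rpow h3, ← log_mul hd0.ne' (by positivity), posLog_apply]
    exact le_max_of_le_right (log_le_log (by positivity) h8)
  rw [div_le_iff₀ (by linarith)] at h5
  linarith

theorem zero_le_liminf_coe {u : ℝ → ℝ} (h : ∀ᶠ r in 𝓝[>] (0 : ℝ), 0 ≤ u r) :
    0 ≤ liminf (fun r => (u r : EReal)) (𝓝[>] 0) := by
  refine le_liminf_of_le (by isBoundedDefault) ?_
  filter_upwards [h] with r hr
  exact_mod_cast hr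

theorem lowerOrder_nonneg (p : ℕ) (f : ℂ → ℂ) (z₀ : ℂ) : 0 ≤ lowerOrder (p + 1) 2 f z₀ := by
  refine zero_le_liminf_coe ?_
  filter_upwards [(tendsto_log_atTop.comp tendsto_log_one_div).eventually_ge_atTop 0] with r hr
  rw [Function.iterate_succ_apply']
  exact div_nonneg posLog_nonneg hr

theorem logType_nonneg {f : ℂ → ℂ} {z₀ : ℂ} (hf : MeromorphicOffPoint f z₀) :
    0 ≤ logType f z₀ := by
  refine le_trans (zero_le_liminf_coe ?_) (liminf_le_limsup)
  filter_upwards [eventually_le_one, tendsto_log_one_div.eventually_ge_atTop 0] with r hr hl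
  exact div_nonneg (characteristic_nonneg hf hr.1 hr.2) (rpow_nonneg hl _)

theorem logLowerType_nonneg {f : ℂ → ℂ} {z₀ : ℂ} (hf : MeromorphicOffPoint f z₀) :
    0 ≤ logLowerType f z₀ := by
  refine zero_le_liminf_coe ?_
  filter_upwards [eventually_le_one, tendsto_log_one_div.eventually_ge_atTop 0] with r hr hl
  exact div_nonneg (characteristic_nonneg hf hr.1 hr.2) (rpow_nonneg hl _)

theorem logLowerOrder_le_logOrder (f : ℂ → ℂ) (z₀ : ℂ) : logLowerOrder f z₀ ≤ logOrder f z₀ :=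
  liminf_le_limsup

theorem one_le_logLowerOrder_of_log_le {f : ℂ → ℂ} {z₀ : ℂ} {C : ℝ}
    (h : ∀ r, 0 < r → r ≤ 1 → log (1 / r) - C ≤ characteristic f z₀ r) :
    1 ≤ logLowerOrder f z₀ := by
  refine EReal.ge_of_forall_gt_iff_ge.1 fun s hs => ?_
  have hs1 : s < 1 := by exact_mod_cast hs
  refine le_liminf_of_le (by isBoundedDefault) ?_
  have hloglog := tendsto_log_atTop.comp tendsto_log_one_div
  filter_upwards [eventually_le_one, tendsto_log_one_div.eventually_ge_atTop (2 * |C|),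
    tendsto_log_one_div.eventually_gt_atTop 0, hloglog.eventually_gt_atTop 0,
    hloglog.eventually_ge_atTop (log 2 / (1 - s))] with r hr h1 h2 h3 h4
  simp only [Function.comp_apply] at h3 h4
  norm_cast
  simp only [Function.iterate_succ, Function.iterate_zero,
    Function.comp_apply, id_eq]
  rw [le_div_iff₀ h3]
  rw [div_le_iff₀ (by linarith)] at h4
  have h5 : log (1 / r) / 2 ≤ characteristic f z₀ r := by
    have := h r hr.1 hr.2
    have := le_abs_self C
    linarith
  have h6 : log (log (1 / r)) - log 2 ≤ log⁺ (characteristic f z₀ r) := by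
    rw [← log_div h2.ne' two_ne_zero, posLog_apply]
    exact le_max_of_le_right (log_le_log (by positivity) h5)
  linarith

/-- For `s` strictly between the order and `m`, the power `L^s` with `L = log (1 / r)` is eventually
below any multiple `ε * L^m`. -/
theorem eventually_characteristic_le_of_logOrder_lt {f : ℂ → ℂ} {z₀ : ℂ} {m ε : ℝ}
    (hf : MeromorphicOffPoint f z₀) (h : logOrder f z₀ < (m : EReal)) (hε : 0 < ε) :
    ∀ᶠ r in 𝓝[>] (0 : ℝ), characteristic f z₀ r ≤ ε * log (1 / r) ^ m := by
  obtain ⟨s, hs1, hs2⟩ := EReal.lt_iff_exists_real_btwn.1 h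
  have hsm : s < m := by exact_mod_cast hs2
  have hev := eventually_lt_of_limsup_lt hs1
  have hloglog := tendsto_log_atTop.comp tendsto_log_one_div
  filter_upwards [hev, eventually_le_one, tendsto_log_one_div.eventually_gt_atTop 0,
    hloglog.eventually_gt_atTop 0,
    hloglog.eventually_ge_atTop (-log ε / (m - s))] with r h1 hr h2 h3 h4
  simp only [Function.comp_apply] at h3 h4
  simp only [Function.iterate_succ, Function.iterate_zero,
    Function.comp_apply, id_eq] at h1
  have h1' := EReal.coe_lt_coe_iff.1 h1
  rw [div_lt_iff₀ h3] at h1'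
  rw [div_le_iff₀ (by linarith)] at h4
  rcases (characteristic_nonneg hf hr.1 hr.2).eq_or_lt with h0 | h0
  · rw [← h0]
    positivity
  · rw [← log_le_log_iff h0 (by positivity), log_mul hε.ne' (by positivity), log_rpow h2]
    have : log (characteristic f z₀ r) ≤ log⁺ (characteristic f z₀ r) := le_max_right _ _
    linarith

theorem eventually_characteristic_le_of_logType_lt {f : ℂ → ℂ} {z₀ : ℂ} {m t : ℝ}
    (ho : logOrder f z₀ = (m : EReal)) (h : logType f z₀ < (t : EReal)) :
    ∀ᶠ r in 𝓝[>] (0 : ℝ), characteristic f z₀ r ≤ t * log (1 / r) ^ m := by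
  rw [logType, ho, EReal.toReal_coe] at h
  filter_upwards [eventually_lt_of_limsup_lt h, tendsto_log_one_div.eventually_gt_atTop 0]
    with r h1 h2
  have h1' := EReal.coe_lt_coe_iff.1 h1
  exact ((div_lt_iff₀ (by positivity)).1 h1').le

theorem eventually_le_characteristic_of_lt_logLowerType {f : ℂ → ℂ} {z₀ : ℂ} {m t : ℝ}
    (ho : logLowerOrder f z₀ = (m : EReal)) (h : (t : EReal) < logLowerType f z₀) :
    ∀ᶠ r in 𝓝[>] (0 : ℝ), t * log (1 / r) ^ m ≤ characteristic f z₀ r := by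
  rw [logLowerType, ho, EReal.toReal_coe] at h
  filter_upwards [eventually_lt_of_lt_liminf h, tendsto_log_one_div.eventually_gt_atTop 0]
    with r h1 h2
  have h1' := EReal.coe_lt_coe_iff.1 h1
  exact ((lt_div_iff₀ (by positivity)).1 h1').le

theorem eventually_mul_characteristic_le_proximity {f : ℂ → ℂ} {z₀ : ℂ} {δ d : ℝ}
    (hf : MeromorphicOffPoint f z₀)
    (h : liminf (fun r : ℝ => ((proximity f z₀ r / characteristic f z₀ r : ℝ) : EReal)) (𝓝[>] 0)
      = (δ : EReal)) (hd : d < δ) (hd0 : 0 < d) :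
    ∀ᶠ r in 𝓝[>] (0 : ℝ), d * characteristic f z₀ r ≤ proximity f z₀ r := by
  have hlt : (d : EReal) < liminf (fun r : ℝ =>
      ((proximity f z₀ r / characteristic f z₀ r : ℝ) : EReal)) (𝓝[>] 0) := by
    rw [h]
    exact_mod_cast hd
  filter_upwards [eventually_lt_of_lt_liminf hlt, eventually_le_one] with r h1 hr
  have h1' := EReal.coe_lt_coe_iff.1 h1
  rcases (characteristic_nonneg hf hr.1 hr.2).eq_or_lt with h0 | h0
  -- Where the characteristic vanishes the quotient is `0` by convention, which contradicts `0 < d`.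
  · rw [← h0, div_zero] at h1'
    linarith
  · exact ((lt_div_iff₀ h0).1 h1').le

/-- A coefficient of logarithmic order less than `1` is constant. -/
theorem eventuallyEq_const_of_logLowerOrder_lt_one {f : ℂ → ℂ} {z₀ : ℂ}
    (hf : MeromorphicOffPoint f z₀) (h : logLowerOrder f z₀ < 1) :
    ∃ a : ℂ, inInvCoord f z₀ =ᶠ[codiscrete ℂ] fun _ => a := by
  refine (eventuallyEq_const_or_log_le_characteristic (meromorphic_inInvCoord hf)).resolve_right ?_
  rintro ⟨C, hC⟩
  refine h.not_ge (one_le_logLowerOrder_of_log_le (C := C) fun r hr hr1 => ?_)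
  rw [characteristic_eq hf hr, one_div]
  exact hC _ ((one_le_inv₀ hr).2 hr1)

end NevanlinnaNear

/-! ### Comparison of the coefficients and the conclusion -/

namespace NevanlinnaNear

open Real

theorem coe_toReal_of_sum_lt_top {ι : Type*} {s : Finset ι} {x : ι → EReal}
    (h0 : ∀ i ∈ s, 0 ≤ x i) (h : ∑ i ∈ s, x i < ⊤) {i : ι} (hi : i ∈ s) :
    ((x i).toReal : EReal) = x i :=
  EReal.coe_toReal ((Finset.single_le_sum h0 hi).trans_lt h).ne
    (EReal.bot_lt_zero.trans_le (h0 i hi)).ne'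

theorem coe_sum_toReal_eq_sum {ι : Type*} {s : Finset ι} {x : ι → EReal} (h0 : ∀ i ∈ s, 0 ≤ x i)
    (h : ∑ i ∈ s, x i < ⊤) : ((∑ i ∈ s, (x i).toReal : ℝ) : EReal) = ∑ i ∈ s, x i := by
  rw [← Finset.sum_congr rfl fun i hi => coe_toReal_of_sum_lt_top h0 h hi]
  exact map_sum (⟨⟨Real.toEReal, EReal.coe_zero⟩, EReal.coe_add⟩ : ℝ →+ EReal) _ s

/-- Both sides are continuous at `ε = 0`. One `ε` pays for all passages from upper and lower limits
to eventual inequalities. -/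
theorem exists_pos_add_sum_lt_mul {ι : Type*} (s : Finset ι) {u : ι → ℝ} {δ τ : ℝ}
    (hδ : 0 < δ) (h : ∑ i ∈ s, u i < δ * τ) :
    ∃ ε, 0 < ε ∧ ε < δ ∧ ∑ i ∈ s, (u i + ε) < (δ - ε) * (τ - ε) := by
  have h1 : Tendsto (fun ε : ℝ => ∑ i ∈ s, (u i + ε)) (𝓝[>] 0) (𝓝 (∑ i ∈ s, (u i + 0))) := by
    have : Continuous fun ε : ℝ => ∑ i ∈ s, (u i + ε) := by fun_prop
    exact (this.tendsto 0).mono_left nhdsWithin_le_nhds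
  have h2 : Tendsto (fun ε : ℝ => (δ - ε) * (τ - ε)) (𝓝[>] 0) (𝓝 ((δ - 0) * (τ - 0))) := by
    have : Continuous fun ε : ℝ => (δ - ε) * (τ - ε) := by fun_prop
    exact (this.tendsto 0).mono_left nhdsWithin_le_nhds
  simp only [add_zero, sub_zero] at h1 h2
  obtain ⟨ε, h3, h4⟩ := ((h1.eventually_lt h2 h).and (Ioo_mem_nhdsGT hδ)).exists
  exact ⟨ε, h4.1, h4.2, h3⟩

/-- If all coefficients have logarithmic lower order less than `1`, then the proximity function of
`A 0` vanishes. -/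
theorem proximity_coeff_zero_eq_zero {z₀ : ℂ} {m : ℕ} {A : ℕ → ℂ → ℂ}
    (hA : ∀ j < m + 1, MeromorphicOffPoint (A j) z₀)
    (hlow : ∀ j < m + 1, logLowerOrder (A j) z₀ < 1)
    {f : ℂ → ℂ} (hf : MeromorphicOffPoint f z₀)
    (hf_ne : ¬ f =ᶠ[codiscreteWithin ({z₀}ᶜ : Set ℂ)] 0) (hsol : IsSolution (m + 1) A z₀ f)
    {r : ℝ} (hr : 0 < r) : proximity (A 0) z₀ r = 0 := by
  have hconst : ∀ j, ∃ a : ℂ, j < m + 1 → inInvCoord (A j) z₀ =ᶠ[codiscrete ℂ] fun _ => a := by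
    intro j
    by_cases hj : j < m + 1
    · obtain ⟨a, ha⟩ := eventuallyEq_const_of_logLowerOrder_lt_one (hA j hj) (hlow j hj)
      exact ⟨a, fun _ => ha⟩
    · exact ⟨0, fun h => absurd h hj⟩
  choose c hc using hconst
  have h0 := coeff_zero_eq_zero_of_const (B := fun j => inInvCoord (A j) z₀)
    (meromorphic_inInvCoord hf)
    (meromorphicOrderAt_inInvCoord_ne_top hf hf_ne)
    (hsol.invDeriv_add_sum_eventuallyEq_zero hA hf) hc
  rw [proximity_eq, ValueDistribution.proximity_congr_codiscrete (hc 0 m.succ_pos)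
    (inv_ne_zero hr.ne'), ValueDistribution.proximity_const, h0, norm_zero]
  exact posLog_zero

/-- The growth of the solution forced by the dominance of the coefficient `A 0`. -/
theorem le_lowerOrder_of_dominant {z₀ : ℂ} {m : ℕ} {A : ℕ → ℂ → ℂ}
    (hA : ∀ j < m + 1, MeromorphicOffPoint (A j) z₀)
    {f : ℂ → ℂ} (hf : MeromorphicOffPoint f z₀)
    (hf_ne : ¬ f =ᶠ[codiscreteWithin ({z₀}ᶜ : Set ℂ)] 0) (hsol : IsSolution (m + 1) A z₀ f)
    {μ c c' : ℝ} (hμ : 1 < μ) (hcc : c' < c)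
    (h0 : ∀ᶠ r in 𝓝[>] (0 : ℝ), c * log (1 / r) ^ μ ≤ proximity (A 0) z₀ r)
    (h1 : ∀ᶠ r in 𝓝[>] (0 : ℝ), ∑ j ∈ Finset.range m, characteristic (A (j + 1)) z₀ r
      ≤ c' * log (1 / r) ^ μ) :
    (μ : EReal) ≤ lowerOrder 2 2 f z₀ := by
  obtain ⟨C, hC, hle⟩ := exists_proximity_coeff_zero_le (B := fun j => inInvCoord (A j) z₀)
    (meromorphic_inInvCoord hf) (fun j hj => meromorphic_inInvCoord (hA j hj))
    (meromorphicOrderAt_inInvCoord_ne_top hf hf_ne)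
    (hsol.invDeriv_add_sum_eventuallyEq_zero hA hf)
  have hmain : ∀ᶠ r : ℝ in 𝓝[>] 0, (c - c') * log (1 / r) ^ μ
      ≤ C * (1 + log (1 / r) + log⁺ (characteristic f z₀ (r / 6 ^ (m + 1)))) := by
    filter_upwards [h0, h1, eventually_le_one] with r h2 h3 hr
    have h4 := hle r⁻¹ ((one_le_inv₀ hr.1).2 hr.2)
    have h5 : (6 : ℝ) ^ (m + 1) * r⁻¹ = (r / 6 ^ (m + 1))⁻¹ := by
      rw [inv_div, div_eq_mul_inv]
    rw [h5, ← characteristic_eq hf (div_pos hr.1 (by positivity)), ← proximity_eq, ← one_div] at h4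
    have h6 : ∑ j ∈ Finset.range m,
        ValueDistribution.characteristic (inInvCoord (A (j + 1)) z₀) ⊤ (1 / r)
        = ∑ j ∈ Finset.range m, characteristic (A (j + 1)) z₀ r := by
      refine Finset.sum_congr rfl fun j hj => ?_
      rw [one_div, characteristic_eq (hA _ (Nat.succ_lt_succ (Finset.mem_range.1 hj))) hr.1]
    rw [h6] at h4
    linarith
  refine EReal.ge_of_forall_gt_iff_ge.1 fun s hs => ?_
  refine le_liminf_of_le (by isBoundedDefault) ?_
  filter_upwards [eventually_le_posLog_posLog_div hμ (sub_pos.2 hcc) hC (by positivity) hmain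
    (EReal.coe_lt_coe_iff.1 hs)] with r hr
  exact_mod_cast hr

end NevanlinnaNear

open NevanlinnaNear in
theorem theorem3 (z₀ : ℂ) (k : ℕ) (hk : 1 ≤ k) (A : ℕ → ℂ → ℂ)
    (hA : ∀ j < k, NevanlinnaNear.MeromorphicOffPoint (A j) z₀)
    (hfin : ∀ j < k, NevanlinnaNear.logOrder (A j) z₀ < ⊤)
    (δ : ℝ) (hδ : 0 < δ)
    (hliminf : liminf (fun r : ℝ =>
      ((NevanlinnaNear.proximity (A 0) z₀ r / NevanlinnaNear.characteristic (A 0) z₀ r : ℝ) :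
        EReal)) (𝓝[>] 0) = (δ : EReal))
    (hmax : ∀ j < k, j ≠ 0 →
      NevanlinnaNear.logOrder (A j) z₀ ≤ NevanlinnaNear.logLowerOrder (A 0) z₀)
    (htype : ∑ j ∈ Finset.Ico 1 k with
        (NevanlinnaNear.logOrder (A j) z₀ = NevanlinnaNear.logLowerOrder (A 0) z₀ ∧
          1 ≤ NevanlinnaNear.logLowerOrder (A 0) z₀),
        NevanlinnaNear.logType (A j) z₀
      < (δ : EReal) * NevanlinnaNear.logLowerType (A 0) z₀)
    (htype_fin : (δ : EReal) * NevanlinnaNear.logLowerType (A 0) z₀ < ⊤)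
    (f : ℂ → ℂ) (hf : NevanlinnaNear.MeromorphicOffPoint f z₀)
    (hf_ne : ¬ f =ᶠ[codiscreteWithin ({z₀}ᶜ : Set ℂ)] 0)
    (hsol : NevanlinnaNear.IsSolution k A z₀ f) :
    0 ≤ NevanlinnaNear.logLowerOrder (A 0) z₀ - 1 ∧
      NevanlinnaNear.logLowerOrder (A 0) z₀ - 1 ≤ NevanlinnaNear.lowerOrder 2 2 f z₀ ∧
      (1 < NevanlinnaNear.logLowerOrder (A 0) z₀ →
        NevanlinnaNear.logLowerOrder (A 0) z₀ ≤ NevanlinnaNear.lowerOrder 2 2 f z₀) := by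
  obtain ⟨m, rfl⟩ : ∃ m, k = m + 1 := ⟨k - 1, by omega⟩
  have hA0 := hA 0 m.succ_pos
  obtain ⟨μ, hμ⟩ : ∃ μ : ℝ, logLowerOrder (A 0) z₀ = (μ : EReal) :=
    ⟨_, (EReal.coe_toReal ((logLowerOrder_le_logOrder _ _).trans_lt (hfin 0 m.succ_pos)).ne
      (EReal.bot_lt_zero.trans_le (lowerOrder_nonneg 0 _ _)).ne').symm⟩
  obtain ⟨τ, hτ⟩ : ∃ τ : ℝ, logLowerType (A 0) z₀ = (τ : EReal) := by
    refine ⟨_, (EReal.coe_toReal (fun h => ?_)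
      (EReal.bot_lt_zero.trans_le (logLowerType_nonneg hA0)).ne').symm⟩
    rw [h, EReal.coe_mul_top_of_pos hδ] at htype_fin
    exact lt_irrefl _ htype_fin
  have hone : 1 ≤ μ := by
    by_contra! hlt
    have hlow : ∀ j < m + 1, logLowerOrder (A j) z₀ < 1 := by
      have hμ1 : logLowerOrder (A 0) z₀ < 1 := by
        rw [hμ]
        exact_mod_cast hlt
      intro j hj
      rcases eq_or_ne j 0 with rfl | h0
      · exact hμ1
      · exact ((logLowerOrder_le_logOrder _ _).trans (hmax j hj h0)).trans_lt hμ1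
    -- All coefficients are constant, so the proximity of `A 0` is identically `0`, against `δ > 0`.
    have hzero : liminf (fun r : ℝ =>
        ((proximity (A 0) z₀ r / characteristic (A 0) z₀ r : ℝ) : EReal)) (𝓝[>] 0) = 0 := by
      rw [liminf_congr (v := fun _ => (0 : EReal)), liminf_const]
      filter_upwards [self_mem_nhdsWithin] with r hr
      rw [proximity_coeff_zero_eq_zero hA hlow hf hf_ne hsol hr, zero_div, EReal.coe_zero]
    rw [hzero] at hliminf
    exact hδ.ne (by exact_mod_cast hliminf)
  have hmain : 1 < μ → (μ : EReal) ≤ lowerOrder 2 2 f z₀ := by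
    intro hμ1
    have h1 : (1 : EReal) ≤ μ := by exact_mod_cast hone
    rw [hμ, hτ] at htype
    simp only [h1, and_true] at htype
    have hnonneg : ∀ j ∈ (Finset.Ico 1 (m + 1)).filter fun j => logOrder (A j) z₀ = (μ : EReal),
        0 ≤ logType (A j) z₀ := fun j hj =>
      logType_nonneg (hA j (Finset.mem_Ico.1 (Finset.mem_filter.1 hj).1).2)
    have hcoe := @coe_toReal_of_sum_lt_top _ _ _ hnonneg (htype.trans_le le_top)
    rw [← coe_sum_toReal_eq_sum hnonneg (htype.trans_le le_top), ← EReal.coe_mul, EReal.coe_lt_coe_iff, Finset.sum_filter,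
      Finset.sum_Ico_eq_sum_range] at htype
    simp only [Nat.add_sub_cancel, add_comm 1] at htype
    obtain ⟨ε, hε, hεδ, hsum⟩ := exists_pos_add_sum_lt_mul _ hδ htype
    refine le_lowerOrder_of_dominant hA hf hf_ne hsol hμ1 hsum ?_ ?_
    · have hτ' : ((τ - ε : ℝ) : EReal) < logLowerType (A 0) z₀ := by
        rw [hτ, EReal.coe_lt_coe_iff]
        linarith
      filter_upwards [eventually_mul_characteristic_le_proximity hA0 hliminf
        (sub_lt_self δ hε) (sub_pos.2 hεδ),
        eventually_le_characteristic_of_lt_logLowerType hμ hτ'] with r h2 h3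
      rw [mul_assoc]
      exact (mul_le_mul_of_nonneg_left h3 (sub_pos.2 hεδ).le).trans h2
    -- Coefficients of order exactly `μ` are bounded through their type; those of smaller order cost
    -- only `ε`.
    · have hj : ∀ j ∈ Finset.range m, ∀ᶠ r in 𝓝[>] (0 : ℝ), characteristic (A (j + 1)) z₀ r
          ≤ ((if logOrder (A (j + 1)) z₀ = (μ : EReal) then (logType (A (j + 1)) z₀).toReal
            else 0) + ε) * Real.log (1 / r) ^ μ := by
        intro j hj
        have hjm : j + 1 < m + 1 := Nat.succ_lt_succ (Finset.mem_range.1 hj)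
        split_ifs with ho
        · refine eventually_characteristic_le_of_logType_lt ho ?_
          rw [← hcoe (Finset.mem_filter.2 ⟨Finset.mem_Ico.2 ⟨by omega, hjm⟩, ho⟩),
            EReal.coe_lt_coe_iff]
          exact lt_add_of_pos_right _ hε
        · rw [zero_add]
          exact eventually_characteristic_le_of_logOrder_lt (hA _ hjm)
            (((hmax _ hjm j.succ_ne_zero).trans_eq hμ).lt_of_ne ho) hε
      filter_upwards [(Filter.eventually_all_finset _).2 hj] with r hr
      rw [Finset.sum_mul]
      exact Finset.sum_le_sum hr
  rw [hμ]
  refine ⟨?_, ?_, fun h => hmain (by exact_mod_cast h)⟩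
  · exact_mod_cast sub_nonneg.2 hone
  -- At `μ = 1` only nonnegativity of the order of `f` is needed.
  · rcases hone.eq_or_lt with h | h
    · rw [← h]
      have : ((1 : ℝ) : EReal) - 1 = 0 := by norm_cast
      rw [this]
      exact lowerOrder_nonneg 1 _ _
    · refine le_trans ?_ (hmain h)
      exact_mod_cast (sub_le_self μ zero_le_one)
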